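/- Let $n\ge 0$. For $q=(q_1,\dots,q_{n+1})\in(\mathbb C^\times)^{n+1}$ let $\Lambda^q(\tilde A_n)$ be the deformed multiplicative preprojective algebra of the cyclic quiver: the quotient of the complex path algebra (paths composed like maps) of the quiver with vertices $1,\dots,n+1$ (indices modulo $n+1$), arrows $\alpha_i:i\to i+1$, $\alpha_i^*:i+1\to i$ $(1\le i\le n+1)$ and loops $z,z^{-1}$ at the vertex $n+1$, by the relations $$zz^{-1}=z^{-1}z=e_{n+1},\qquad z=e_{n+1}+\alpha_{n+1}^*\alpha_{n+1},\qquad e_i+\alpha_{i-1}\alpha_{i-1}^*=q_ie_i+q_i\alpha_i^*\alpha_i\quad(1\le i\le n+1),$$ where $e_i$ is the trivial path at $i$. For an algebra $R$ let $D^b(R)$ be the bounded derived category of finitely generated right $R$-modules, that is, the Verdier quotient by the acyclic complexes of the homotopy category of complexes of finitely generated right $R$-modules with bounded homology; $D^b(\mathrm{Coh}(S))$ is defined in the same way from coherent sheaves on a scheme $S$. For a polynomial $P\in\mathbb C[Z]$ put $X_{\mathrm{Mil}}=\operatorname{Spec}\mathbb C[X,Y,Z]/(P(Z)-XY)$ and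 $D_m=\{Z=0\}\subset X_{\mathrm{Mil}}$. (1) Suppose $q_1\cdots q_{n+1}=1$, put $Q_i=q_1\cdots q_i$, $B=\Lambda^q(\tilde A_n)$ and $A=e_{n+1}Be_{n+1}$, and let $P$ be a polynomial of degree $n+1$ whose roots, with multiplicity, are $Q_1,\dots,Q_{n+1}$. Then there is an isomorphism of $\mathbb C$-algebras $A\cong\mathbb C[X,Y,Z^{\pm1}]/(P(Z)-XY)$. The roots of $P$ are distinct if and only if $$\prod_{l=i}^{j}q_l\neq1\quad\text{for all }1\le i\le j\le n,$$ and in this case there are triangulated equivalences $$D^b(B)\simeq D^b(A),\qquad D^b(\mathrm{Coh}(X_{\mathrm{Mil}}\smallsetminus D_m))\simeq D^b(\Lambda^q(\tilde A_n)).$$ (2) Conversely, let $P$ be any polynomial of degree $n+1$ without repeated roots and with $P(0)\ne0$, and let $\rho_1,\dots,\rho_{n+1}$ be its roots in any order. Then there is $q\in(\mathbb C^\times)^{n+1}$ with $q_1\cdots q_{n+1}=1$ and $\rho_i=\rho_{n+1}\,q_1\cdots q_i$ for all $i$ (so $\rho_i=q_1\cdots q_i$ if $\rho_{n+1}=1$),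 such that $D^b(\mathrm{Coh}(X_{\mathrm{Mil}}\smallsetminus D_m))\simeq D^b(\Lambda^q(\tilde A_n))$ as triangulated categories. -/

import Mathlib

open CategoryTheory CategoryTheory.Limits

/-! ### Path algebras -/

section PathAlgebra

variable (k : Type) [CommRing k] {V E : Type} [Fintype V] (s t : E → V)

/-- Relations between the trivial paths (`inl v`) and the arrows (`inr a`) of a finite quiver with
source and target maps `s`, `t`. Paths are composed like maps: `b * a` is `a` followed by `b`. -/
inductive PathAlgebra.Rel : FreeAlgebra k (V ⊕ E) → FreeAlgebra k (V ⊕ E) → Prop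
  | idem (v : V) : Rel (FreeAlgebra.ι k (.inl v) * FreeAlgebra.ι k (.inl v))
      (FreeAlgebra.ι k (.inl v))
  | orth (v w : V) (h : v ≠ w) : Rel (FreeAlgebra.ι k (.inl v) * FreeAlgebra.ι k (.inl w)) 0
  | complete : Rel (∑ v, FreeAlgebra.ι k (.inl v)) 1
  | target (a : E) : Rel (FreeAlgebra.ι k (.inl (t a)) * FreeAlgebra.ι k (.inr a))
      (FreeAlgebra.ι k (.inr a))
  | source (a : E) : Rel (FreeAlgebra.ι k (.inr a) * FreeAlgebra.ι k (.inl (s a)))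
      (FreeAlgebra.ι k (.inr a))

/-- The path algebra of the quiver `(V, E, s, t)` with finitely many vertices. -/
abbrev PathAlgebra : Type := RingQuot (PathAlgebra.Rel k s t)

/-- The trivial path at `v`. -/
def PathAlgebra.vertex (v : V) : PathAlgebra k s t :=
  RingQuot.mkAlgHom k _ (FreeAlgebra.ι k (.inl v))

/-- The path of length one given by an arrow. -/
def PathAlgebra.arrow (a : E) : PathAlgebra k s t :=
  RingQuot.mkAlgHom k _ (FreeAlgebra.ι k (.inr a))

lemma PathAlgebra.vertex_mul_self (v : V) : vertex k s t v * vertex k s t v = vertex k s t v := by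
  simpa [vertex] using RingQuot.mkAlgHom_rel k (Rel.idem (k := k) (s := s) (t := t) v)

end PathAlgebra

/-! ### The deformed multiplicative preprojective algebra of type `Ã_n` -/

/-- Arrows of the doubled cyclic quiver `Ã_n` with two extra loops at the last vertex. The vertices
are `Fin (n + 1)`, the element `i` standing for the vertex `i + 1`, so that `Fin.last n` is the
vertex `n + 1`; additions and subtractions of `1` are modulo `n + 1`. -/
inductive CyclicArrow (n : ℕ) : Type
  | alpha (i : Fin (n + 1))
  | alphaStar (i : Fin (n + 1))
  | z
  | zInv

def CyclicArrow.source {n : ℕ} : CyclicArrow n → Fin (n + 1)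
  | alpha i => i
  | alphaStar i => i + 1
  | z => Fin.last n
  | zInv => Fin.last n

def CyclicArrow.target {n : ℕ} : CyclicArrow n → Fin (n + 1)
  | alpha i => i + 1
  | alphaStar i => i
  | z => Fin.last n
  | zInv => Fin.last n

section MultiplicativePreprojective

variable {n : ℕ} (q : Fin (n + 1) → ℂˣ)

abbrev CyclicPathAlgebra (n : ℕ) : Type :=
  PathAlgebra ℂ (CyclicArrow.source (n := n)) CyclicArrow.target

abbrev pathVertex (i : Fin (n + 1)) : CyclicPathAlgebra n := PathAlgebra.vertex ℂ _ _ i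

abbrev pathArrow (a : CyclicArrow n) : CyclicPathAlgebra n := PathAlgebra.arrow ℂ _ _ a

inductive MultPreprojRel : CyclicPathAlgebra n → CyclicPathAlgebra n → Prop
  | z_mul_zInv : MultPreprojRel (pathArrow .z * pathArrow .zInv) (pathVertex (Fin.last n))
  | zInv_mul_z : MultPreprojRel (pathArrow .zInv * pathArrow .z) (pathVertex (Fin.last n))
  | z_eq : MultPreprojRel (pathArrow .z) (pathVertex (Fin.last n) +
      pathArrow (.alphaStar (Fin.last n)) * pathArrow (.alpha (Fin.last n)))
  | vertex (i : Fin (n + 1)) : MultPreprojRel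
      (pathVertex i + pathArrow (.alpha (i - 1)) * pathArrow (.alphaStar (i - 1)))
      ((q i : ℂ) • pathVertex i +
        (q i : ℂ) • (pathArrow (.alphaStar i) * pathArrow (.alpha i)))

/-- The deformed multiplicative preprojective algebra `Λ^q(Ã_n)`. -/
def MultPreproj : Type := RingQuot (MultPreprojRel q)

noncomputable instance : Ring (MultPreproj q) := inferInstanceAs (Ring (RingQuot (MultPreprojRel q)))

noncomputable instance : Algebra ℂ (MultPreproj q) :=
  inferInstanceAs (Algebra ℂ (RingQuot (MultPreprojRel q)))

/-- The quotient map from the path algebra. -/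
noncomputable def MultPreproj.mk : CyclicPathAlgebra n →ₐ[ℂ] MultPreproj q :=
  RingQuot.mkAlgHom ℂ (MultPreprojRel q)

/-- The idempotent of `Λ^q(Ã_n)` at a vertex. -/
noncomputable def MultPreproj.e (i : Fin (n + 1)) : MultPreproj q := mk q (pathVertex i)

lemma MultPreproj.isIdempotentElem_e (i : Fin (n + 1)) : IsIdempotentElem (e q i) := by
  rw [IsIdempotentElem, e, ← map_mul, PathAlgebra.vertex_mul_self]

/-- The partial products `Q_i = q_1 ⋯ q_i`. -/
noncomputable def partialProduct (i : Fin (n + 1)) : ℂˣ := ∏ j ∈ Finset.Iic i, q j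

/-- No product of consecutive `q_l`, `i ≤ l ≤ j ≤ n`, equals `1`. -/
def NoTrivialConsecutiveProduct : Prop :=
  ∀ i j : Fin (n + 1), i ≤ j → j < Fin.last n → ∏ l ∈ Finset.Icc i j, q l ≠ 1

end MultiplicativePreprojective

section Corner

variable {k B : Type} [CommRing k] [Ring B] [Algebra k B] {e : B}

instance (h : IsIdempotentElem e) : Algebra k h.Corner :=
  RingHom.toAlgebra'
    { toFun := fun c => ⟨c • e, c • e, by simp [h.eq]⟩
      map_one' := Subtype.ext (one_smul k e)
      map_mul' := fun c d => Subtype.ext (by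
        change (c * d) • e = (c • e) * (d • e)
        rw [smul_mul_smul_comm, h.eq])
      map_zero' := Subtype.ext (zero_smul k e)
      map_add' := fun c d => Subtype.ext (add_smul c d e) }
    (fun c x => Subtype.ext (by
      have hx := (Subsemigroup.mem_corner_iff h).1 x.2
      change (c • e) * x.1 = x.1 * (c • e)
      simp [hx.1, hx.2]))

/-- The corner algebra `e_{n+1} Λ^q(Ã_n) e_{n+1}`. -/
abbrev MultPreproj.Corner {n : ℕ} (q : Fin (n + 1) → ℂˣ) : Type :=
  (MultPreproj.isIdempotentElem_e q (Fin.last n)).Corner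

end Corner

/-! ### Bounded derived categories -/

lemma ObjectProperty.isClosedUnderBinaryProducts_of_biprod {C : Type*} [Category C] [Abelian C]
    (P : ObjectProperty C) [P.IsClosedUnderIsomorphisms]
    (h : ∀ X Y : C, P X → P Y → P (X ⊞ Y)) : P.IsClosedUnderBinaryProducts where
  limitsOfShape_le := by
    rintro X ⟨p⟩
    refine P.prop_of_iso ?_ (h _ _ (p.prop_diag_obj (.mk .left)) (p.prop_diag_obj (.mk .right)))
    exact IsLimit.conePointUniqueUpToIso (BinaryBiproduct.isLimit _ _)
      ((IsLimit.postcomposeHomEquiv (diagramIsoPair p.diag) _).2 p.isLimit)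

instance {C : Type*} [Category C] [Abelian C] (P : ObjectProperty C)
    [P.IsClosedUnderBinaryProducts] : HasBinaryBiproducts P.FullSubcategory :=
  HasBinaryBiproducts.of_hasBinaryProducts

section DerivedCategories

universe v u v' u'

variable {C : Type u} [Category.{v} C] [Abelian C]

/-- The property of a complex (up to homotopy) of having bounded homology. -/
def boundedHomology (C : Type u) [Category.{v} C] [Abelian C] :
    ObjectProperty (HomotopyCategory C (ComplexShape.up ℤ)) := fun X =>
  ∃ a b : ℤ, ∀ i : ℤ, i < a ∨ b < i →
    IsZero ((HomotopyCategory.homologyFunctor C (ComplexShape.up ℤ) i).obj X)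

instance : (boundedHomology C).IsClosedUnderIsomorphisms where
  of_iso e := by
    rintro ⟨a, b, h⟩
    exact ⟨a, b, fun i hi => (h i hi).of_iso
      ((HomotopyCategory.homologyFunctor C (ComplexShape.up ℤ) i).mapIso e.symm)⟩

instance : (boundedHomology C).IsTriangulated where
  exists_zero := ⟨_, isZero_zero _, 0, 0, fun i _ => Functor.map_isZero _ (isZero_zero _)⟩
  isStableUnderShiftBy n := ⟨by
    rintro X ⟨a, b, h⟩
    refine ⟨a - n, b - n, fun i hi => (h (n + i) (by lia)).of_iso ?_⟩
    exact ((HomotopyCategory.homologyFunctor C (ComplexShape.up ℤ) 0).shiftIso n i (n + i) rfl).app X⟩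
  toIsTriangulatedClosed₂ := .mk' (by
    rintro T hT ⟨a₁, b₁, h₁⟩ ⟨a₃, b₃, h₃⟩
    refine ⟨min a₁ a₃, max b₁ b₃, fun i hi => ?_⟩
    have h := (HomotopyCategory.homologyFunctor C (ComplexShape.up ℤ) 0).homologySequence_exact₂
      T hT i
    exact h.isZero_of_both_zeros ((h₁ i (by lia)).eq_of_src _ _) ((h₃ i (by lia)).eq_of_tgt _ _))

section

variable (P : ObjectProperty C) [HasZeroObject P.FullSubcategory]
  [HasBinaryBiproducts P.FullSubcategory]

/-- The homotopy category of (cohomologically indexed, unbounded) complexes with terms satisfying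
`P` and with bounded homology, the homology being computed in the ambient abelian category. -/
abbrev HomotopyCategoryBounded : Type _ :=
  ((boundedHomology C).inverseImage (P.ι.mapHomotopyCategory (ComplexShape.up ℤ))).FullSubcategory

/-- The acyclic complexes. -/
def acyclicObjects : ObjectProperty (HomotopyCategoryBounded P) :=
  (HomotopyCategory.subcategoryAcyclic C).inverseImage
    (ObjectProperty.ι _ ⋙ P.ι.mapHomotopyCategory (ComplexShape.up ℤ))

instance : (acyclicObjects P).IsTriangulated := by
  dsimp [acyclicObjects]; infer_instance

/-- The bounded derived category of the objects satisfying `P`: the Verdier quotient of the homotopy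
category of complexes of such objects with bounded homology by the acyclic complexes, i.e. its
localisation at quasi-isomorphisms. -/
def BoundedDerivedCategory : Type _ := (acyclicObjects P).trW.Localization

namespace BoundedDerivedCategory

noncomputable section

instance : Category (BoundedDerivedCategory P) :=
  inferInstanceAs (Category (acyclicObjects P).trW.Localization)

instance : Preadditive (BoundedDerivedCategory P) :=
  inferInstanceAs (Preadditive (acyclicObjects P).trW.Localization)

instance : HasZeroObject (BoundedDerivedCategory P) :=
  inferInstanceAs (HasZeroObject (acyclicObjects P).trW.Localization)

instance : HasShift (BoundedDerivedCategory P) ℤ :=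
  inferInstanceAs (HasShift (acyclicObjects P).trW.Localization ℤ)

instance (n : ℤ) : (shiftFunctor (BoundedDerivedCategory P) n).Additive :=
  inferInstanceAs (shiftFunctor (acyclicObjects P).trW.Localization n).Additive

instance : Pretriangulated (BoundedDerivedCategory P) :=
  inferInstanceAs (Pretriangulated (acyclicObjects P).trW.Localization)

end

end BoundedDerivedCategory

end

/-- There is a triangulated equivalence between `C` and `D`. -/
def TriangulatedEquivalent (C : Type u) [Category.{v} C] [HasShift C ℤ] [Preadditive C]
    [HasZeroObject C] [∀ n : ℤ, (shiftFunctor C n).Additive] [Pretriangulated C]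
    (D : Type u') [Category.{v'} D] [HasShift D ℤ] [Preadditive D]
    [HasZeroObject D] [∀ n : ℤ, (shiftFunctor D n).Additive] [Pretriangulated D] : Prop :=
  ∃ (F : C ⥤ D) (_ : F.CommShift ℤ), F.IsTriangulated ∧ F.IsEquivalence

end DerivedCategories

section FG

variable (A : Type) [Ring A]


instance : (ModuleCat.isFG.{0} A).IsClosedUnderIsomorphisms where
  of_iso {M N} e h := by
    have : Module.Finite A M := h
    exact Module.Finite.equiv e.toLinearEquiv

instance : (ModuleCat.isFG.{0} A).ContainsZero where
  exists_zero := ⟨.of A PUnit, ModuleCat.isZero_of_subsingleton _,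
    inferInstanceAs (Module.Finite A PUnit)⟩

instance : (ModuleCat.isFG.{0} A).IsClosedUnderBinaryProducts :=
  ObjectProperty.isClosedUnderBinaryProducts_of_biprod _ fun M N hM hN => by
    have : Module.Finite A M := hM
    have : Module.Finite A N := hN
    exact Module.Finite.equiv (ModuleCat.biprodIsoProd M N).symm.toLinearEquiv

/-- `D^b(A)`: the bounded derived category of finitely generated right `A`-modules. -/
abbrev DbMod : Type _ := BoundedDerivedCategory (ModuleCat.isFG.{0} Aᵐᵒᵖ)

end FG


section Coh
open AlgebraicGeometry ZeroObject Scheme.Modules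

lemma isQuasicoherent_of_affine {X : Scheme.{0}} (M : X.Modules)
    (h : ∀ (U : X.Opens) (hU : IsAffineOpen U),
      ((restrictFunctor hU.fromSpec).obj M).IsQuasicoherent) : M.IsQuasicoherent := by
  have key (U : X.affineOpens) : Nonempty (SheafOfModules.Presentation (SheafOfModules.over M U.1)) := by
    have hU : IsAffineOpen U.1 := U.2
    have := h U.1 hU
    let p₀ : SheafOfModules.Presentation ((restrictFunctor hU.fromSpec).obj M) :=
      @SheafOfModules.Presentation.ofIsIso.{0, 0, 0} _ _ _ _ _ _ _ _ (fromTildeΓ _)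
        (isIso_fromTildeΓ_of_isQuasicoherent _) (presentationTilde.{0} _ .univ (by simp) _ (Submodule.span_eq _))
    let p₁ := presentationRestrict hU.isoSpec.hom p₀
    let e : restrict ((restrictFunctor hU.fromSpec).obj M) hU.isoSpec.hom ≅
        (overEquiv U.1).functor.obj (SheafOfModules.over M U.1) :=
      (restrictFunctorComp hU.isoSpec.hom hU.fromSpec).symm.app M ≪≫
        (restrictFunctorCongr (by simp)).app M ≪≫ ((overFunctorEquiv U.1).symm.app M)
    let p₂ := @SheafOfModules.Presentation.ofIsIso.{0, 0, 0} _ _ _ _ _ _ _ _ e.hom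
      (Iso.isIso_hom e) p₁
    let G := TopologicalSpace.Opens.sheafOfModulesEquivOver U.1 X.ringCatSheaf
    have : PreservesColimitsOfSize.{0, 0} G.inverse :=
      G.symm.toAdjunction.leftAdjoint_preservesColimits
    exact ⟨@SheafOfModules.Presentation.ofIsIso.{0, 0, 0} _ _ _ _ _ _ _ _
      ((overEquiv U.1).unitIso.symm.app _).hom (Iso.isIso_hom _)
      (SheafOfModules.Presentation.map (R := U.1.sheafRestrict.obj X.ringCatSheaf) (S := X.ringCatSheaf.over U.1) p₂ G.inverse
        (TopologicalSpace.Opens.sheafOfModulesEquivOverInverseUnit _ _).symm)⟩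
  refine SheafOfModules.QuasicoherentData.isQuasicoherent
    { I := X.affineOpens, X := fun U => U.1, coversTop := ?_, presentation := fun U => (key U).some }
  rw [Opens.coversTop_iff]
  exact iSup_affineOpens_eq_top X

/-- Coherent sheaves: quasi-coherent sheaves of modules whose sections over every affine open `U`
form a finitely generated `Γ(X, U)`-module. (This is the standard notion on locally Noetherian
schemes, the only ones it is used for.) -/
def coherentSheaves (X : Scheme.{0}) : ObjectProperty X.Modules := fun M =>
  M.IsQuasicoherent ∧ ∀ U : X.Opens, IsAffineOpen U → Module.Finite Γ(X, U) Γ(M, U)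

instance (X : Scheme.{0}) : (coherentSheaves X).IsClosedUnderIsomorphisms where
  of_iso {M N} e h := by
    refine ⟨(SheafOfModules.isQuasicoherent X.ringCatSheaf).prop_of_iso e h.1, fun U hU => ?_⟩
    have := h.2 U hU
    let f : Γ(M, U) →ₗ[Γ(X, U)] Γ(N, U) :=
      { toFun := e.hom.app U, map_add' := map_add _, map_smul' := fun r x => e.hom.app_smul r x }
    refine Module.Finite.of_surjective f fun y => ⟨e.inv.app U y, ?_⟩
    change (e.inv.app U ≫ e.hom.app U) y = y
    rw [← Scheme.Modules.Hom.comp_app]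
    simp

lemma restrictFunctor_additive {X Y : Scheme.{0}} (f : X ⟶ Y) [IsOpenImmersion f] :
    (restrictFunctor f).Additive where
  map_add := rfl

instance (X : Scheme.{0}) : (coherentSheaves X).ContainsZero where
  exists_zero := by
    refine ⟨0, isZero_zero _, isQuasicoherent_of_affine _ fun U hU => ?_, fun U _ => ?_⟩
    · have := restrictFunctor_additive hU.fromSpec
      have h0 : IsZero ((restrictFunctor hU.fromSpec).obj (0 : X.Modules)) :=
        Functor.map_isZero _ (isZero_zero _)
      have h1 : IsZero ((tilde.functor Γ(X, U)).obj 0) := Functor.map_isZero _ (isZero_zero _)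
      exact (SheafOfModules.isQuasicoherent _).prop_of_iso (h1.iso h0)
        (inferInstanceAs ((tilde.functor Γ(X, U)).obj 0).IsQuasicoherent)
    · have : Subsingleton Γ((0 : X.Modules), U) := subsingleton_of_forall_eq 0 fun x => by
        have : (𝟙 (0 : X.Modules) : (0 : X.Modules) ⟶ 0).app U x = (0 : (0 : X.Modules) ⟶ 0).app U x := by
          rw [(isZero_zero X.Modules).eq_of_src (𝟙 _) 0]
        exact this
      infer_instance

instance (X : Scheme.{0}) : (coherentSheaves X).IsClosedUnderBinaryProducts := by
  refine ObjectProperty.isClosedUnderBinaryProducts_of_biprod _ fun M N hM hN => ⟨?_, fun U hU => ?_⟩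
  · refine isQuasicoherent_of_affine _ fun U hU => ?_
    have := restrictFunctor_additive hU.fromSpec
    have := hM.1
    have := hN.1
    let F := restrictFunctor hU.fromSpec
    have : (F.obj M).IsQuasicoherent := isQuasicoherent_restrictFunctor _ M
    have : (F.obj N).IsQuasicoherent := isQuasicoherent_restrictFunctor _ N
    have : PreservesBinaryBiproducts F := preservesBinaryBiproducts_of_preservesBiproducts _
    have : PreservesBinaryBiproducts (tilde.functor Γ(X, U)) :=
      preservesBinaryBiproducts_of_preservesBiproducts _
    let A := moduleSpecΓFunctor.obj (F.obj M)
    let B := moduleSpecΓFunctor.obj (F.obj N)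
    let e : (tilde.functor Γ(X, U)).obj (A ⊞ B) ≅ F.obj (M ⊞ N) :=
      (tilde.functor Γ(X, U)).mapBiprod A B ≪≫
        biprod.mapIso (@asIso _ _ _ _ (F.obj M).fromTildeΓ (isIso_fromTildeΓ_of_isQuasicoherent _)) (@asIso _ _ _ _ (F.obj N).fromTildeΓ (isIso_fromTildeΓ_of_isQuasicoherent _)) ≪≫
        (F.mapBiprod M N).symm
    exact (SheafOfModules.isQuasicoherent _).prop_of_iso e
        (inferInstanceAs ((tilde.functor Γ(X, U)).obj (A ⊞ B)).IsQuasicoherent)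
  · have := hM.2 U hU
    have := hN.2 U hU
    let f : Γ(M, U) × Γ(N, U) →ₗ[Γ(X, U)] Γ(M ⊞ N, U) :=
      { toFun x := (biprod.inl : M ⟶ M ⊞ N).app U x.1 + (biprod.inr : N ⟶ M ⊞ N).app U x.2
        map_add' x y := by simp only [Prod.fst_add, Prod.snd_add, map_add]; abel
        map_smul' r x := by
          simp only [Prod.smul_fst, Prod.smul_snd, RingHom.id_apply, smul_add]
          rw [Hom.app_smul, Hom.app_smul] }
    refine Module.Finite.of_surjective f fun y =>
      ⟨((biprod.fst : M ⊞ N ⟶ M).app U y, (biprod.snd : M ⊞ N ⟶ N).app U y), ?_⟩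
    change ((biprod.fst ≫ biprod.inl + biprod.snd ≫ biprod.inr : M ⊞ N ⟶ M ⊞ N)).app U y = y
    rw [biprod.total]
    rfl

/-- `D^b(Coh(X))`. -/
abbrev DbCoh (X : Scheme.{0}) : Type _ := BoundedDerivedCategory (coherentSheaves X)

end Coh

/-! ### The Milnor fibre with a fibre removed -/

section Milnor

open Polynomial LaurentPolynomial AlgebraicGeometry

/-- `ℂ[X, Y, Z] / (P(Z) - XY)`, with `X`, `Y`, `Z` the variables `0`, `1`, `2`. -/
abbrev MilnorFibreRing (P : ℂ[X]) : Type :=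
  MvPolynomial (Fin 3) ℂ ⧸ Ideal.span
    {aeval (MvPolynomial.X 2 : MvPolynomial (Fin 3) ℂ) P - MvPolynomial.X 0 * MvPolynomial.X 1}

/-- `ℂ[X, Y, Z^{±1}] / (P(Z) - XY)`, as a quotient of `ℂ[Z^{±1}][X, Y]`. -/
abbrev LocalizedMilnorFibreRing (P : ℂ[X]) : Type :=
  MvPolynomial (Fin 2) ℂ[T;T⁻¹] ⧸ Ideal.span
    {(MvPolynomial.C (toLaurent P) : MvPolynomial (Fin 2) ℂ[T;T⁻¹]) -
      MvPolynomial.X 0 * MvPolynomial.X 1}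

/-- The affine variety `X_Mil = {P(Z) = XY}`. -/
noncomputable abbrev milnorFibre (P : ℂ[X]) : Scheme.{0} := Spec (.of (MilnorFibreRing P))

/-- The open subscheme `X_Mil ∖ D_m`, where `D_m = {Z = 0}`. -/
noncomputable def milnorFibreComplement (P : ℂ[X]) : Scheme.{0} :=
  Scheme.Opens.toScheme (X := milnorFibre P)
    (PrimeSpectrum.basicOpen (Ideal.Quotient.mk _ (MvPolynomial.X 2) : MilnorFibreRing P))

end Milnor

/-! ### Triangulated equivalences and Verdier quotients. -/

section TriangulatedEquivalent

universe v₁ v₂ v₃ u₁ u₂ u₃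

variable {C : Type u₁} [Category.{v₁} C] [HasShift C ℤ] [Preadditive C]
    [HasZeroObject C] [∀ n : ℤ, (shiftFunctor C n).Additive] [Pretriangulated C]
    {D : Type u₂} [Category.{v₂} D] [HasShift D ℤ] [Preadditive D]
    [HasZeroObject D] [∀ n : ℤ, (shiftFunctor D n).Additive] [Pretriangulated D]
    {E : Type u₃} [Category.{v₃} E] [HasShift E ℤ] [Preadditive E]
    [HasZeroObject E] [∀ n : ℤ, (shiftFunctor E n).Additive] [Pretriangulated E]

/-! Everything rests on the element `central`, c = ∑ Q_i (e_i + α_i^* α_i). Since q_1 ⋯ q_{n+1} = 1,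
the recursion Q_{i+1} = Q_i q_{i+1} holds cyclically, and the vertex relations say that c is also
given at i+1 by Q_i (e_{i+1} + α_i α_i^*). Hence c commutes with all arrows (`central_commute`). Its
component at the last vertex is z, and its invertibility spreads from there around the cycle
(`isUnit_central`). Both α_i α_i^* and α_i^* α_i become the central factor Q_i⁻¹ c - 1 times an
idempotent.

Corner. With a = ∑ α_i and b = ∑ α_i^*, the algebra is spanned over ℂ[c^{±1}] by the e_i a^m and e_i
b^m (`mem_closure_monomials`). At the last vertex only the powers of X = a^{n+1} and Y = b^{n+1}
survive. They are independent because `matrixRep` sends X to T^{n+1} and Y to (∏ linear factors)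
T^{-(n+1)}. The ring R[X, Y]/(p - XY), R = ℂ[Z^{±1}], is spanned by its signed monomials and embeds
in R[T^{±1}] in the same way. Up to a unit rescaling of Y the two algebras have the same image, so
they are isomorphic (`nonempty_corner_algEquiv`).

Morita equivalence. Travelling from the last vertex to another vertex and back puts a product of
factors c - Q_j, times the idempotent of that vertex, in the ideal generated by e_{n+1}. The two
directions around the cycle give coprime polynomials when the Q_j are distinct, so the idempotent is
full (`one_mem_span_e_last`). A full corner has an equivalent module category, compatibly with
finite generation (`IsFullCorner.triangulatedEquivalent`).

Geometry. The complement of Z = 0 is the spectrum of the localised ring, and M ↦ M^~ identifies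
finitely generated modules with coherent sheaves. Passage to derived categories is uniform: a fully
faithful exact functor matching two subcategories induces a triangulated equivalence
(`BoundedDerivedCategory.triangulatedEquivalent`).

For the converse, q_i = ρ_i/ρ_{i-1} makes the roots ρ_{n+1} Q_i. The scalar ρ carried through the
corner computation, with Z ↦ ρ c, absorbs the factor ρ_{n+1}. -/

lemma TriangulatedEquivalent.symm (h : TriangulatedEquivalent C D) :
    TriangulatedEquivalent D C := by
  obtain ⟨F, _, _, _⟩ := h
  obtain ⟨G, rfl⟩ : ∃ G : C ≌ D, G.functor = F := ⟨F.asEquivalence, rfl⟩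
  let := G.commShiftInverse ℤ
  have := G.commShift_of_functor ℤ
  have : G.IsTriangulated := .mk' G inferInstance
  exact ⟨G.inverse, inferInstance, inferInstance, inferInstance⟩

lemma TriangulatedEquivalent.trans (h : TriangulatedEquivalent C D)
    (h' : TriangulatedEquivalent D E) : TriangulatedEquivalent C E := by
  obtain ⟨F, _, _, _⟩ := h
  obtain ⟨G, _, _, _⟩ := h'
  exact ⟨F ⋙ G, inferInstance, inferInstance, inferInstance⟩

/-- A triangulated equivalence matching two triangulated subcategories induces a triangulated
equivalence of the Verdier quotients. -/
lemma TriangulatedEquivalent.verdierQuotient [IsTriangulated C] [IsTriangulated D]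
    (P : ObjectProperty C) [P.IsTriangulated]
    (Q : ObjectProperty D) [Q.IsTriangulated] [Q.IsClosedUnderIsomorphisms]
    (F : C ⥤ D) [F.CommShift ℤ] [F.IsTriangulated] [F.IsEquivalence]
    (hPQ : P = Q.inverseImage F) :
    TriangulatedEquivalent P.trW.Localization Q.trW.Localization := by
  have hW {X Y : C} (f : X ⟶ Y) : P.trW f ↔ Q.trW (F.map f) := by
    subst hPQ
    exact Q.inverseImage_trW_iff F f
  obtain ⟨Φ, rfl⟩ : ∃ Φ : LocalizerMorphism P.trW Q.trW, Φ.functor = F :=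
    ⟨{ functor := F, map := fun X Y f hf => (hW f).1 hf }, rfl⟩
  have : Φ.IsLocalizedEquivalence := by
    -- It remains to see that each morphism inverted downstairs is isomorphic, as an arrow, to the
    -- image of one inverted upstairs: conjugate it by the counit and take a preimage under the full
    -- functor.
    refine LocalizerMorphism.IsLocalizedEquivalence.of_equivalence Φ fun X Y f hf => ?_
    let e := Φ.functor.asEquivalence
    have w : e.counitIso.hom.app X ≫ f =
        (e.counitIso.hom.app X ≫ f ≫ e.counitIso.inv.app Y) ≫ e.counitIso.hom.app Y := by
      rw [Category.assoc, Category.assoc, Iso.inv_hom_id_app]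
      exact congrArg _ (Category.comp_id f).symm
    let i : Arrow.mk (e.counitIso.hom.app X ≫ f ≫ e.counitIso.inv.app Y) ≅ Arrow.mk f :=
      Arrow.isoMk (e.counitIso.app X) (e.counitIso.app Y) w
    have hi : Φ.functor.map (Φ.functor.preimage (e.counitIso.hom.app X ≫ f ≫
      e.counitIso.inv.app Y)) = e.counitIso.hom.app X ≫ f ≫ e.counitIso.inv.app Y :=
        Φ.functor.map_preimage _
    refine ⟨_, _, Φ.functor.preimage (e.counitIso.hom.app X ≫ f ≫ e.counitIso.inv.app Y), ?_, ⟨?_⟩⟩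
    · rw [hW, hi]
      exact (Q.trW.arrow_mk_iso_iff i).2 hf
    · rw [hi]
      exact i
  refine ⟨Φ.localizedFunctor P.trW.Q Q.trW.Q, inferInstance, ?_, inferInstance⟩
  -- Every morphism of the quotient comes, up to isomorphism, from one upstairs, so being
  -- triangulated can be tested after composition with the quotient functor.
  have : P.trW.Q.mapArrow.EssSurj := Localization.essSurj_mapArrow _ P.trW
  let e := CatCommSq.iso Φ.functor P.trW.Q Q.trW.Q (Φ.localizedFunctor P.trW.Q Q.trW.Q)
  have h : NatTrans.CommShift e.hom ℤ := inferInstance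
  have : NatTrans.CommShift e.symm.hom ℤ := inferInstanceAs (NatTrans.CommShift e.inv ℤ)
  exact Functor.isTriangulated_of_precomp_iso e.symm

end TriangulatedEquivalent

/-! ### Exact functors and bounded derived categories. -/

section Bounded

universe v₁ v₂ u₁ u₂

variable {C : Type u₁} [Category.{v₁} C] [Abelian C] {D : Type u₂} [Category.{v₂} D] [Abelian D]

/-- An exact functor commutes with taking the homology of complexes up to homotopy. -/
noncomputable def homologyMapHomotopyCategoryIso (F : C ⥤ D) [F.Additive] [F.PreservesHomology]
    (K : HomotopyCategory C (ComplexShape.up ℤ)) (i : ℤ) :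
    (HomotopyCategory.homologyFunctor D (ComplexShape.up ℤ) i).obj
      ((F.mapHomotopyCategory (ComplexShape.up ℤ)).obj K) ≅
    F.obj ((HomotopyCategory.homologyFunctor C (ComplexShape.up ℤ) i).obj K) :=
  (HomotopyCategory.homologyFunctorFactors D (ComplexShape.up ℤ) i).app
      ((F.mapHomologicalComplex _).obj K.as) ≪≫
    (K.as.sc i).mapHomologyIso F ≪≫
    F.mapIso ((HomotopyCategory.homologyFunctorFactors C (ComplexShape.up ℤ) i).app K.as).symm

variable (F : C ⥤ D) [F.Additive] [F.PreservesHomology] [F.Full] [F.Faithful]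

omit [F.Full] in
-- Exactness moves F past homology, and a faithful additive functor reflects zero objects because it
-- reflects the vanishing of the identity.
lemma isZero_homology_mapHomotopyCategory_iff (K : HomotopyCategory C (ComplexShape.up ℤ)) (i : ℤ) :
    IsZero ((HomotopyCategory.homologyFunctor D (ComplexShape.up ℤ) i).obj
      ((F.mapHomotopyCategory (ComplexShape.up ℤ)).obj K)) ↔
    IsZero ((HomotopyCategory.homologyFunctor C (ComplexShape.up ℤ) i).obj K) :=
  (homologyMapHomotopyCategoryIso F K i).isZero_iff.trans
    ⟨fun h => (IsZero.iff_id_eq_zero _).2 (F.map_injective (h.eq_of_src _ _)), F.map_isZero⟩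

variable (P : ObjectProperty C) [HasZeroObject P.FullSubcategory]
  [HasBinaryBiproducts P.FullSubcategory]
  (Q : ObjectProperty D) [HasZeroObject Q.FullSubcategory]
  [HasBinaryBiproducts Q.FullSubcategory]

/-- A fully faithful exact functor between abelian categories which matches two full subcategories
induces a triangulated equivalence of their bounded derived categories. -/
theorem BoundedDerivedCategory.triangulatedEquivalent (hP : ∀ X, P X → Q (F.obj X))
    (hQ : ∀ Y, Q Y → ∃ X, P X ∧ Nonempty (F.obj X ≅ Y)) :
    TriangulatedEquivalent (BoundedDerivedCategory P) (BoundedDerivedCategory Q) := by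
  let F' : P.FullSubcategory ⥤ Q.FullSubcategory := Q.lift (P.ι ⋙ F) fun X => hP _ X.2
  let e : F' ⋙ Q.ι ≅ P.ι ⋙ F := Q.liftCompιIso _ _
  have : F'.Additive := ⟨fun {X Y f g} => by
    ext; exact F.map_add (f := f.hom) (g := g.hom)⟩
  have : F'.Full := inferInstance
  have : F'.Faithful := inferInstance
  have : F'.EssSurj := ⟨fun Y => by
    obtain ⟨X, hX, ⟨i⟩⟩ := hQ _ Y.2
    exact ⟨⟨X, hX⟩, ⟨ObjectProperty.isoMk _ i⟩⟩⟩
  have : F'.IsEquivalence := {}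
  let c := ComplexShape.up ℤ
  let H := F'.mapHomotopyCategory c
  let ε : H ⋙ Q.ι.mapHomotopyCategory c ≅ P.ι.mapHomotopyCategory c ⋙ F.mapHomotopyCategory c :=
    Functor.mapHomotopyCategoryCompIso e c ≪≫
      (Functor.mapHomotopyCategoryCompIso (Iso.refl (P.ι ⋙ F)) c).symm
  -- Homology lives in the ambient abelian categories. This one comparison matches both the bounded
  -- complexes and the acyclic ones.
  have hz (K : HomotopyCategory P.FullSubcategory c) (i : ℤ) :
      IsZero ((HomotopyCategory.homologyFunctor D c i).obj
        ((Q.ι.mapHomotopyCategory c).obj (H.obj K))) ↔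
      IsZero ((HomotopyCategory.homologyFunctor C c i).obj ((P.ι.mapHomotopyCategory c).obj K)) :=
    ((HomotopyCategory.homologyFunctor D c i).mapIso (ε.app K)).isZero_iff.trans
      (isZero_homology_mapHomotopyCategory_iff F _ i)
  have hB (K : HomotopyCategory P.FullSubcategory c) :
      ((boundedHomology D).inverseImage (Q.ι.mapHomotopyCategory c)) (H.obj K) ↔
        ((boundedHomology C).inverseImage (P.ι.mapHomotopyCategory c)) K :=
    exists_congr fun a => exists_congr fun b => forall_congr' fun i => imp_congr_right fun _ => hz K i
  let G : HomotopyCategoryBounded P ⥤ HomotopyCategoryBounded Q :=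
    ObjectProperty.lift _ (ObjectProperty.ι _ ⋙ H) fun K => (hB _).2 K.2
  let : G.CommShift ℤ := inferInstanceAs ((ObjectProperty.lift _ _ _).CommShift ℤ)
  have : G.IsTriangulated := inferInstanceAs (ObjectProperty.lift _ _ _).IsTriangulated
  have : G.Full := inferInstance
  have : G.Faithful := inferInstance
  have : G.EssSurj := ⟨fun L => by
    -- The lift is made on actual complexes, by a termwise inverse of `F'`, before passing to
    -- homotopy classes.
    obtain ⟨K, ⟨i⟩⟩ : ∃ K, Nonempty ((F'.mapHomologicalComplex c).obj K ≅ L.obj.as) :=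
      by
        have : F'.asEquivalence.functor.Additive := ‹F'.Additive›
        exact ⟨_, ⟨(F'.asEquivalence.mapHomologicalComplex c).counitIso.app L.obj.as⟩⟩
    let i' : H.obj ((HomotopyCategory.quotient _ _).obj K) ≅ L.obj :=
      (HomotopyCategory.quotient _ _).mapIso i
    exact ⟨⟨_, (hB _).1 (ObjectProperty.prop_of_iso _ i'.symm L.2)⟩, ⟨ObjectProperty.isoMk _ i'⟩⟩⟩
  have : G.IsEquivalence := {}
  have : (acyclicObjects Q).IsClosedUnderIsomorphisms := by
    dsimp only [acyclicObjects]; infer_instance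
  refine TriangulatedEquivalent.verdierQuotient (acyclicObjects P) (acyclicObjects Q) G ?_
  ext K
  change HomotopyCategory.subcategoryAcyclic C _ ↔ HomotopyCategory.subcategoryAcyclic D _
  simp only [HomotopyCategory.mem_subcategoryAcyclic_iff]
  exact forall_congr' fun i => (hz K.obj i).symm

end Bounded

/-! ### Exactness of M ↦ M^~. -/

section Tilde

open AlgebraicGeometry Scheme.Modules

universe u
variable {R : CommRingCat.{u}}

/-- Localisation being exact, `M ↦ M^~` sends injections to maps injective on sections. -/
lemma tilde_map_app_injective {M N : ModuleCat.{u} R} (f : M ⟶ N)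
    (hf : Function.Injective f) (U : (Spec R).Opens) :
    Function.Injective (((tilde.functor R).map f).app U) := by
  intro s t hst
  -- A section of M^~ is a family of elements of the localisations of M, so equality is checked at
  -- each point of U.
  refine Subtype.ext (funext fun y => ?_)
  let x : PrimeSpectrum R := y.1
  exact IsLocalizedModule.map_injective x.asIdeal.primeCompl
      (LocalizedModule.mkLinearMap x.asIdeal.primeCompl M)
      (LocalizedModule.mkLinearMap x.asIdeal.primeCompl N) f.hom hf
      (congrFun (congrArg Subtype.val hst) y)

instance : (tilde.functor R).PreservesMonomorphisms where
  preserves {M N} f hf := by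
    refine ⟨fun g h w => Scheme.Modules.hom_ext _ _ fun U => ?_⟩
    ext x
    refine tilde_map_app_injective f ((ModuleCat.mono_iff_injective f).1 hf) U ?_
    exact congr($(congrArg (fun φ => Scheme.Modules.Hom.app φ U) w) x)

/-- A left adjoint preserves cokernels; preserving monomorphisms as well makes it exact. -/
instance : (tilde.functor R).PreservesHomology :=
  Functor.preservesHomology_of_preservesMonos_and_cokernels _

end Tilde

/-! ### Coherent sheaves on affine schemes. -/

section CoherentSheaves

open AlgebraicGeometry Scheme.Modules

/-- Epimorphisms of quasi-coherent sheaves on an affine scheme are surjective on global sections. -/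
lemma app_top_surjective_of_epi {R : CommRingCat.{0}} {M N : (Spec R).Modules} (φ : M ⟶ N) [Epi φ]
    (hM : M.IsQuasicoherent) (hN : N.IsQuasicoherent) : Function.Surjective (φ.app ⊤) := by
  let adj := tilde.adjunction (R := R)
  have hM' : IsIso (adj.counit.app M) := isIso_fromTildeΓ_of_isQuasicoherent M
  have hN' : IsIso (adj.counit.app N) := isIso_fromTildeΓ_of_isQuasicoherent N
  -- Up to the counit isomorphisms φ is the sheafification of its map on global sections, and the
  -- faithful functor M ↦ M^~ reflects epimorphisms.
  have h : Epi ((tilde.functor R).map (moduleSpecΓFunctor.map φ)) := by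
    rw [← epi_comp_iff_of_isIso _ (adj.counit.app N)]
    exact (adj.counit.naturality φ).symm ▸ (epi_comp' inferInstance inferInstance)
  have h' := (tilde.functor R).epi_of_epi_map h
  exact (ModuleCat.epi_iff_surjective (moduleSpecΓFunctor.map φ)).1 h'

/-- Epimorphisms of quasi-coherent sheaves are surjective on sections over affine opens. -/
lemma app_surjective_of_epi {X : Scheme.{0}} {M N : X.Modules} (φ : M ⟶ N) [Epi φ]
    (hM : M.IsQuasicoherent) (hN : N.IsQuasicoherent) (U : X.Opens) (hU : IsAffineOpen U) :
    Function.Surjective (φ.app U) := by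
  have h := app_top_surjective_of_epi ((restrictFunctor hU.fromSpec).map φ)
    (isQuasicoherent_restrictFunctor _ M) (isQuasicoherent_restrictFunctor _ N)
  have h' : Function.Surjective (φ.app (hU.fromSpec ''ᵁ ⊤)) := h
  have e : hU.fromSpec ''ᵁ ⊤ = U := by simp
  rwa [e] at h'

/-- Sections over an affine open of the sheaf associated with a finitely generated module form a
finitely generated module. -/
lemma coherentSheaves_tilde {R : CommRingCat.{0}} (M : ModuleCat.{0} R) [Module.Finite R M] :
    coherentSheaves (Spec R) ((tilde.functor R).obj M) := by
  have hq (N : ModuleCat.{0} R) : ((tilde.functor R).obj N).IsQuasicoherent :=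
    inferInstanceAs (tilde N).IsQuasicoherent
  refine ⟨hq M, fun U hU => ?_⟩
  obtain ⟨n, f, hf⟩ := Module.Finite.exists_fin' R M
  let ι (i : Fin n) : ModuleCat.of R R ⟶ ModuleCat.of R (Fin n → R) :=
    ModuleCat.ofHom (LinearMap.single R (fun _ => R) i)
  let π (i : Fin n) : ModuleCat.of R (Fin n → R) ⟶ ModuleCat.of R R :=
    ModuleCat.ofHom (LinearMap.proj i)
  let g : ModuleCat.of R (Fin n → R) ⟶ M := ModuleCat.ofHom f
  have hπι : ∑ i, π i ≫ ι i = 𝟙 _ := by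
    ext : 1
    refine LinearMap.ext fun x => ?_
    rw [ModuleCat.hom_sum, LinearMap.sum_apply]
    exact LinearMap.sum_single_apply (fun _ => R) x
  have : Epi g := (ModuleCat.epi_iff_surjective _).2 hf
  -- A presentation R^n → M stays surjective over U. Cutting R^n into coordinates by `π` and `ι`
  -- then expresses every section through n copies of the sections of R^~, which are Γ(Spec R, U)
  -- itself.
  have hs := app_surjective_of_epi ((tilde.functor R).map g) (hq _) (hq _) U hU
  have : Module.Finite Γ(Spec R, U) Γ((tilde.functor R).obj (ModuleCat.of R R), U) :=
    inferInstanceAs (Module.Finite Γ(Spec R, U) Γ(Spec R, U))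
  let ψ : (Fin n → Γ((tilde.functor R).obj (ModuleCat.of R R), U)) →ₗ[Γ(Spec R, U)]
      Γ((tilde.functor R).obj M, U) :=
    ∑ i, LinearMap.comp
      { toFun := ((tilde.functor R).map (ι i ≫ g)).app U
        map_add' := map_add _
        map_smul' := fun r x => Scheme.Modules.Hom.app_smul _ r x } (LinearMap.proj i)
  refine Module.Finite.of_surjective ψ fun y => ?_
  obtain ⟨z, rfl⟩ := hs y
  refine ⟨fun i => ((tilde.functor R).map (π i)).app U z, ?_⟩
  have h : (tilde.functor R).map g =
      ∑ i, (tilde.functor R).map (π i) ≫ (tilde.functor R).map (ι i ≫ g) := by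
    simp_rw [← Functor.map_comp, ← Functor.map_sum, ← Category.assoc, ← Preadditive.sum_comp, hπι,
      Category.id_comp]
  let Φ : ((tilde.functor R).obj (ModuleCat.of R (Fin n → R)) ⟶ (tilde.functor R).obj M) →+
      Γ((tilde.functor R).obj M, U) :=
    { toFun := fun φ => φ.app U z
      map_zero' := rfl
      map_add' := fun _ _ => rfl }
  change _ = Φ ((tilde.functor R).map g)
  rw [h, map_sum]
  exact LinearMap.sum_apply _ _ _

/-- A quasi-coherent M is recovered from its global sections by the counit. What remains is to
compare scalars: finiteness is known over Γ(Spec R, ⊤) and needed over R, so the identity map is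
used as a semilinear surjection. -/
lemma exists_tilde_iso_of_coherentSheaves {R : CommRingCat.{0}} (M : (Spec R).Modules)
    (hM : coherentSheaves (Spec R) M) :
    ∃ N : ModuleCat.{0} R, Module.Finite R N ∧ Nonempty ((tilde.functor R).obj N ≅ M) := by
  have : IsIso ((tilde.adjunction (R := R)).counit.app M) :=
    @isIso_fromTildeΓ_of_isQuasicoherent _ M hM.1
  refine ⟨moduleSpecΓFunctor.obj M, ?_, ⟨asIso ((tilde.adjunction (R := R)).counit.app M)⟩⟩
  have := hM.2 ⊤ (isAffineOpen_top _)
  let e := (Scheme.ΓSpecIso R).commRingCatIsoToRingEquiv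
  let f : Γ(M, ⊤) →ₛₗ[(e : Γ(Spec R, ⊤) →+* R)] moduleSpecΓFunctor.obj M :=
    { toFun := id
      map_add' := fun _ _ => rfl
      map_smul' := fun r x => by
        refine Eq.symm ((smul_Spec_def (M := M) (U := ⊤) (e r) x).trans ?_)
        have h : (Spec R).presheaf.map (homOfLE (le_top : (⊤ : (Spec R).Opens) ≤ ⊤)).op
            ((Scheme.ΓSpecIso R).inv (e r)) = r := by
          have h' : (Scheme.ΓSpecIso R).inv (e r) = r := e.symm_apply_apply r
          rw [h']
          exact congr($((Spec R).presheaf.map_id (.op ⊤)) r)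
        exact congrArg (· • x) h }
  exact Module.Finite.of_surjective f Function.surjective_id

/-- `D^b(Coh(Spec R))` is the bounded derived category of finitely generated `R`-modules. -/
theorem triangulatedEquivalent_DbCoh_Spec (R : CommRingCat.{0}) :
    TriangulatedEquivalent (BoundedDerivedCategory (ModuleCat.isFG.{0} R)) (DbCoh (Spec R)) :=
  BoundedDerivedCategory.triangulatedEquivalent (tilde.functor R) _ _
    (fun M hM => have : Module.Finite R M := hM; coherentSheaves_tilde M)
    exists_tilde_iso_of_coherentSheaves

/-- Sections of the restriction over U are the sections of M over the image of U, which is again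
affine; only the scalars change, by the isomorphism `f.appIso U`. -/
lemma coherentSheaves_restrictFunctor {X Y : Scheme.{0}} (f : X ⟶ Y) [IsOpenImmersion f]
    (M : Y.Modules) (hM : coherentSheaves Y M) :
    coherentSheaves X ((restrictFunctor f).obj M) := by
  have := hM.1
  refine ⟨isQuasicoherent_restrictFunctor f M, fun U hU => ?_⟩
  have := hM.2 (f ''ᵁ U) (hU.image_of_isOpenImmersion f)
  let e := (f.appIso U).commRingCatIsoToRingEquiv
  let g : Γ(M, f ''ᵁ U) →ₛₗ[(e : Γ(Y, f ''ᵁ U) →+* Γ(X, U))] Γ((restrictFunctor f).obj M, U) :=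
    { toFun := id
      map_add' := fun _ _ => rfl
      map_smul' := fun r x => by
        have h : (f.appIso U).inv (e r) = r := e.symm_apply_apply r
        exact (congrArg (· • x) h).symm }
  exact Module.Finite.of_surjective g Function.surjective_id

/-- Restriction along an isomorphism of schemes is an equivalence. -/
noncomputable def restrictEquivalence {X Y : Scheme.{0}} (e : X ≅ Y) : Y.Modules ≌ X.Modules :=
  .mk (restrictFunctor e.hom) (restrictFunctor e.inv)
    (restrictFunctorId.symm ≪≫ restrictFunctorCongr e.inv_hom_id.symm ≪≫
      restrictFunctorComp e.inv e.hom)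
    ((restrictFunctorComp e.hom e.inv).symm ≪≫ restrictFunctorCongr e.hom_inv_id ≪≫
      restrictFunctorId)

/-- Isomorphic schemes have equivalent bounded derived categories of coherent sheaves. -/
theorem triangulatedEquivalent_DbCoh_of_iso {X Y : Scheme.{0}} (e : X ≅ Y) :
    TriangulatedEquivalent (DbCoh Y) (DbCoh X) := by
  let E := restrictEquivalence e
  have : E.functor.Additive := restrictFunctor_additive e.hom
  exact BoundedDerivedCategory.triangulatedEquivalent E.functor _ _
    (coherentSheaves_restrictFunctor e.hom)
    fun M hM => ⟨E.inverse.obj M, coherentSheaves_restrictFunctor e.inv M hM,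
      ⟨E.counitIso.app M⟩⟩

end CoherentSheaves

/-! ### Morita equivalence with the corner at a full idempotent. -/

section Morita

variable {A S : Type} [Ring A] [Ring S] (φ : A →ₙ+* S)

/-- A non-unital ring homomorphism identifying `A` with the corner of `S` at the full idempotent
`φ 1`. -/
structure IsFullCorner : Prop where
  injective : Function.Injective φ
  exists_eq (s : S) : ∃ a, φ a = φ 1 * s * φ 1
  full : ∃ (n : ℕ) (x y : Fin n → S), ∑ i, x i * φ 1 * y i = 1

/-- The elements of a module fixed by the idempotent `φ 1`. -/
def CornerModule (M : Type) [AddCommGroup M] [Module S M] : AddSubgroup M where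
  carrier := {m | φ 1 • m = m}
  add_mem' {a b} ha hb := by
    have ha : φ 1 • a = a := ha
    have hb : φ 1 • b = b := hb
    change φ 1 • (a + b) = _
    rw [smul_add, ha, hb]
  zero_mem' := smul_zero _
  neg_mem' {a} ha := by
    have ha : φ 1 • a = a := ha
    change φ 1 • (-a) = _
    rw [smul_neg, ha]

namespace CornerModule

variable {φ} {M N : Type} [AddCommGroup M] [Module S M] [AddCommGroup N] [Module S N]

lemma one_smul_coe (m : CornerModule φ M) : φ 1 • (m : M) = m := m.2

lemma map_one_mul (a : A) : φ 1 * φ a = φ a := by rw [← map_mul, one_mul]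

lemma map_mul_one (a : A) : φ a * φ 1 = φ a := by rw [← map_mul, mul_one]

instance : Module A (CornerModule φ M) where
  smul a m := ⟨φ a • (m : M), by
    change φ 1 • φ a • (m : M) = _
    rw [smul_smul, map_one_mul]⟩
  one_smul m := Subtype.ext m.2
  mul_smul a b m := Subtype.ext (by
    change φ (a * b) • (m : M) = φ a • φ b • (m : M)
    rw [map_mul, mul_smul])
  smul_zero a := Subtype.ext (smul_zero _)
  smul_add a m n := Subtype.ext (smul_add _ _ _)
  add_smul a b m := Subtype.ext (by
    change φ (a + b) • (m : M) = φ a • (m : M) + φ b • (m : M)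
    rw [map_add, add_smul])
  zero_smul m := Subtype.ext (by
    change φ 0 • (m : M) = 0
    rw [map_zero, zero_smul])

@[simp] lemma coe_smul (a : A) (m : CornerModule φ M) :
    ((a • m : CornerModule φ M) : M) = φ a • (m : M) :=
  rfl

variable (φ) in
/-- The projection to the elements fixed by the idempotent. -/
def proj (m : M) : CornerModule φ M := ⟨φ 1 • m, by
  change φ 1 • φ 1 • m = _
  rw [smul_smul, map_one_mul]⟩

@[simp] lemma coe_proj (m : M) : (proj φ m : M) = φ 1 • m := rfl

variable (φ) in
/-- The restriction of a linear map. -/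
def map (f : M →ₗ[S] N) : CornerModule φ M →ₗ[A] CornerModule φ N where
  toFun m := ⟨f m, by
    change φ 1 • f m = _
    rw [← map_smul, one_smul_coe]⟩
  map_add' _ _ := Subtype.ext (map_add f _ _)
  map_smul' _ _ := Subtype.ext (map_smul f _ _)

/-- This is how fullness is used throughout: an element is recovered from finitely many projections
to the corner module. -/
lemma eq_sum {n : ℕ} {x y : Fin n → S} (h : ∑ i, x i * φ 1 * y i = 1) (m : M) :
    m = ∑ i, x i • (proj φ (y i • m) : M) := by
  conv_lhs => rw [← one_smul S m, ← h, Finset.sum_smul]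
  simp only [coe_proj, smul_smul, mul_assoc]

lemma map_injective (hφ : IsFullCorner φ) :
    Function.Injective (map φ : (M →ₗ[S] N) → _) := by
  intro f g h
  obtain ⟨n, x, y, hxy⟩ := hφ.full
  ext m
  rw [eq_sum hxy m, map_sum, map_sum]
  refine Finset.sum_congr rfl fun i _ => ?_
  rw [map_smul, map_smul]
  exact congrArg (x i • ·) (congrArg Subtype.val (LinearMap.congr_fun h (proj φ (y i • m))))

/-- By `eq_sum` an extension of g must be m ↦ ∑ x_i g(φ(1) y_i m). The formula is explicit, so only
S-linearity needs proof. -/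
lemma map_surjective (hφ : IsFullCorner φ) :
    Function.Surjective (map φ : (M →ₗ[S] N) → _) := by
  intro g
  obtain ⟨n, x, y, hxy⟩ := hφ.full
  -- On the corner module, s followed by projection acts as φ(1) s φ(1), which comes from A, and g
  -- is A-linear.
  have key (s : S) (m : CornerModule φ M) : φ 1 • s • (g m : N) = g (proj φ (s • (m : M))) := by
    obtain ⟨a, ha⟩ := hφ.exists_eq s
    have h1 : proj φ (s • (m : M)) = a • m := Subtype.ext (by
      rw [coe_proj, coe_smul, ha, mul_smul, mul_smul, one_smul_coe])
    rw [h1, map_smul, coe_smul, ha, mul_smul, mul_smul, one_smul_coe]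
  have hproj (t : S) (m : M) : g (proj φ (t • m)) =
      ∑ j, φ 1 • (t * x j) • (g (proj φ (y j • m)) : N) := by
    simp_rw [key]
    rw [← AddSubgroup.val_finsetSum, ← map_sum]
    congr 2
    refine Subtype.ext ?_
    rw [AddSubgroup.val_finsetSum]
    conv_lhs => rw [eq_sum hxy m]
    simp only [coe_proj, Finset.smul_sum, smul_smul, mul_assoc]
  let f : M →ₗ[S] N :=
    { toFun := fun m => ∑ i, x i • (g (proj φ (y i • m)) : N)
      map_add' := fun m m' => by
        rw [← Finset.sum_add_distrib]
        refine Finset.sum_congr rfl fun i _ => ?_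
        have : proj φ (y i • (m + m')) = proj φ (y i • m) + proj φ (y i • m') :=
          Subtype.ext (by simp)
        rw [this, map_add, AddSubgroup.coe_add, smul_add]
      map_smul' := fun s m => by
        -- Inserting ∑ x_j φ(1) y_j between s and m lets g be moved past s; summing over i then
        -- cancels ∑ x_i φ(1) y_i.
        have h1 (i : Fin n) : (g (proj φ (y i • s • m)) : N) =
            ∑ j, φ 1 • (y i * s * x j) • (g (proj φ (y j • m)) : N) := by
          rw [smul_smul, hproj]
        rw [RingHom.id_apply, Finset.sum_congr rfl fun i _ => congrArg (x i • ·) (h1 i)]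
        simp only [Finset.smul_sum]
        rw [Finset.sum_comm]
        refine Finset.sum_congr rfl fun j _ => ?_
        simp_rw [smul_smul, ← Finset.sum_smul, ← mul_assoc]
        rw [← Finset.sum_mul, ← Finset.sum_mul, hxy, one_mul] }
  refine ⟨f, LinearMap.ext fun m => Subtype.ext ?_⟩
  change ∑ i, x i • (g (proj φ (y i • (m : M))) : N) = g m
  simp_rw [← key, smul_smul, ← Finset.sum_smul, ← mul_assoc]
  rw [hxy, one_smul]

/-- If the f_k generate M, the elements φ(1) y_i f_k generate the corner module, since φ(1) c f_k =
∑ (φ(1) c x_i φ(1)) (φ(1) y_i f_k) with coefficients from A. -/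
lemma finite (hφ : IsFullCorner φ) [Module.Finite S M] : Module.Finite A (CornerModule φ M) := by
  obtain ⟨n, x, y, hxy⟩ := hφ.full
  obtain ⟨r, f, hf⟩ := Module.Finite.exists_fin' S M
  let v (p : Fin r × Fin n) : CornerModule φ M := proj φ (y p.2 • f (fun j => if p.1 = j then 1 else 0))
  refine ⟨Submodule.fg_def.2 ⟨Set.range v, Set.finite_range v, eq_top_iff.2 fun m _ => ?_⟩⟩
  obtain ⟨c, hc⟩ := hf m
  choose a ha using fun k i => hφ.exists_eq (c k * x i)
  have hm : m = ∑ k, ∑ i, a k i • v (k, i) := by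
    refine Subtype.ext ?_
    simp only [AddSubgroup.val_finsetSum, coe_smul, ha, v, coe_proj]
    rw [← one_smul_coe m, ← hc]
    rw [LinearMap.pi_apply_eq_sum_univ f c, Finset.smul_sum]
    refine Finset.sum_congr rfl fun k _ => ?_
    change φ 1 • c k • f (fun j => if k = j then 1 else 0) = ∑ i, (φ 1 * (c k * x i) * φ 1) • φ 1 •
      y i • f (fun j => if k = j then 1 else 0)
    generalize f (fun j => if k = j then 1 else 0) = w
    simp only [smul_smul, ← Finset.sum_smul]
    congr 1
    conv_lhs => rw [← mul_one (φ 1 * c k), ← hxy, Finset.mul_sum]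
    refine Finset.sum_congr rfl fun i _ => ?_
    simp only [← mul_assoc]
    rw [mul_assoc _ (φ 1) (φ 1), map_one_mul]
  rw [hm]
  exact sum_mem fun k _ => sum_mem fun i _ =>
    Submodule.smul_mem _ _ (Submodule.subset_span ⟨(k, i), rfl⟩)

/-- By `eq_sum` the corner module generates M over S, so its A-generators do too. -/
lemma finite_of_finite (hφ : IsFullCorner φ) [Module.Finite A (CornerModule φ M)] :
    Module.Finite S M := by
  obtain ⟨n, x, y, hxy⟩ := hφ.full
  obtain ⟨s, hs⟩ := Module.Finite.fg_top (R := A) (M := CornerModule φ M)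
  classical
  refine ⟨⟨s.image Subtype.val, ?_⟩⟩
  have h (m : CornerModule φ M) : (m : M) ∈ Submodule.span S (Finset.image Subtype.val s : Set M) := by
    have hm : m ∈ Submodule.span A (s : Set (CornerModule φ M)) := hs ▸ Submodule.mem_top
    induction hm using Submodule.span_induction with
    | mem m hm => exact Submodule.subset_span (by simpa using hm)
    | zero => exact zero_mem _
    | add a b _ _ ha hb => exact add_mem ha hb
    | smul a m _ hm => exact Submodule.smul_mem _ _ hm
  refine eq_top_iff.2 fun m _ => ?_
  rw [eq_sum hxy m]
  exact sum_mem fun i _ => Submodule.smul_mem _ _ (h _)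

variable (φ) in
/-- The functor `M ↦ (φ 1) M` from `S`-modules to modules over the corner. -/
def functor : ModuleCat.{0} S ⥤ ModuleCat.{0} A where
  obj M := ModuleCat.of A (CornerModule φ M)
  map f := ModuleCat.ofHom (map φ f.hom)

instance : (functor φ).Additive where
  map_add := rfl

end CornerModule

variable (N : Type) [AddCommGroup N] [Module A N]

/-- The module `Hom_A((φ 1) S, N)` coinduced from the corner. -/
def CoinducedModule : Type := CornerModule φ S →ₗ[A] N

namespace CoinducedModule

instance : AddCommGroup (CoinducedModule φ N) := inferInstanceAs (AddCommGroup (_ →ₗ[A] N))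

variable {φ}

/-- Right multiplication on `(φ 1) S`. -/
def mulRight (s : S) : CornerModule φ S →ₗ[A] CornerModule φ S where
  toFun t := ⟨t * s, by
    change φ 1 * (t * s) = t * s
    rw [← mul_assoc]
    exact congrArg (· * s) t.2⟩
  map_add' _ _ := Subtype.ext (add_mul _ _ _)
  map_smul' _ _ := Subtype.ext (mul_assoc _ _ _)

variable {N}

/-- The underlying linear map. -/
def toLin (f : CoinducedModule φ N) : CornerModule φ S →ₗ[A] N := f

instance : Module S (CoinducedModule φ N) where
  smul s f := LinearMap.comp f.toLin (mulRight s)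
  one_smul f := LinearMap.ext fun t => congrArg f.toLin (Subtype.ext (mul_one (t : S)))
  mul_smul s s' f := LinearMap.ext fun t => congrArg f.toLin (Subtype.ext (mul_assoc (t : S) s s').symm)
  smul_zero _ := rfl
  smul_add _ _ _ := rfl
  add_smul s s' f := LinearMap.ext fun t =>
    (congrArg f.toLin (Subtype.ext (mul_add (t : S) s s'))).trans (map_add f.toLin _ _)
  zero_smul f := LinearMap.ext fun t =>
    (congrArg f.toLin (Subtype.ext (mul_zero (t : S)))).trans (map_zero f.toLin)

/-- The idempotent as an element of `(φ 1) S`. -/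
def idem : CornerModule φ S := ⟨φ 1, CornerModule.map_one_mul 1⟩

lemma apply_mul_idem (f : CornerModule φ (CoinducedModule φ N)) (t : CornerModule φ S) :
    f.1.toLin (mulRight (φ 1) t) = f.1.toLin t :=
  LinearMap.congr_fun (congrArg toLin f.2) t

/-- Evaluation at the idempotent. -/
def eval : CornerModule φ (CoinducedModule φ N) →ₗ[A] N where
  toFun f := f.1.toLin idem
  map_add' _ _ := rfl
  map_smul' a f := by
    change f.1.toLin (mulRight (φ a) idem) = a • f.1.toLin idem
    rw [← map_smul f.1.toLin]
    refine congrArg f.1.toLin (Subtype.ext ?_)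
    change φ 1 * φ a = φ a * φ 1
    rw [CornerModule.map_one_mul, CornerModule.map_mul_one]

/-- A fixed f satisfies f(t) = f(t φ(1)), and t φ(1) is an A-multiple of the idempotent, so f is
determined by its value there. Conversely n comes from t ↦ a(t) n, where φ(a(t)) = φ(1) t φ(1). -/
lemma eval_bijective (hφ : IsFullCorner φ) :
    Function.Bijective (eval : CornerModule φ (CoinducedModule φ N) → N) := by
  choose a ha using hφ.exists_eq
  constructor
  · intro f g h
    refine Subtype.ext (LinearMap.ext fun t => ?_)
    change f.1.toLin t = g.1.toLin t
    rw [← apply_mul_idem f, ← apply_mul_idem g]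
    have h1 : mulRight (φ 1) t = a (t : S) • idem := by
      refine Subtype.ext ?_
      change (t : S) * φ 1 = φ (a t) * φ 1
      rw [CornerModule.map_mul_one, ha]
      exact congrArg (· * φ 1) t.2.symm
    rw [h1, map_smul, map_smul]
    exact congrArg (a (t : S) • ·) h
  · intro n
    let g : CoinducedModule φ N :=
      { toFun := fun t => a t • n
        map_add' := fun t t' => by
          rw [← add_smul]
          congr 1
          apply hφ.injective
          rw [map_add, ha, ha, ha, AddSubgroup.coe_add, mul_add, add_mul]
        map_smul' := fun b t => by
          rw [RingHom.id_apply, smul_smul]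
          congr 1
          apply hφ.injective
          rw [map_mul, ha, ha, CornerModule.coe_smul, smul_eq_mul, ← mul_assoc, ← mul_assoc,
            ← mul_assoc, CornerModule.map_one_mul, CornerModule.map_mul_one] }
    have hg : φ 1 • g = g := LinearMap.ext fun t => by
      change a (t * φ 1) • n = a t • n
      congr 1
      apply hφ.injective
      rw [ha, ha, ← mul_assoc, mul_assoc _ (φ 1) (φ 1), CornerModule.map_one_mul]
    refine ⟨⟨g, hg⟩, ?_⟩
    change a (φ 1) • n = n
    have : a (φ 1) = 1 := hφ.injective (by
      rw [ha, CornerModule.map_one_mul, CornerModule.map_one_mul])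
    rw [this, one_smul]

end CoinducedModule

variable {φ}

lemma CornerModule.isEquivalence_functor (hφ : IsFullCorner φ) : (functor φ).IsEquivalence where
  faithful := ⟨fun {M N f g} h => ModuleCat.hom_ext
    (map_injective hφ (congrArg ModuleCat.Hom.hom h))⟩
  full := ⟨fun {M N} g => by
    obtain ⟨f, hf⟩ := map_surjective (M := M) (N := N) hφ g.hom
    exact ⟨ModuleCat.ofHom f, ModuleCat.hom_ext hf⟩⟩
  essSurj := ⟨fun N => ⟨ModuleCat.of S (CoinducedModule φ N),
    ⟨(LinearEquiv.ofBijective CoinducedModule.eval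
      (CoinducedModule.eval_bijective hφ)).toModuleIso⟩⟩⟩

/-- The Morita equivalence between a ring and the corner at a full idempotent, on bounded derived
categories of finitely generated modules. -/
theorem IsFullCorner.triangulatedEquivalent (hφ : IsFullCorner φ) :
    TriangulatedEquivalent (BoundedDerivedCategory (ModuleCat.isFG.{0} S))
      (BoundedDerivedCategory (ModuleCat.isFG.{0} A)) := by
  have := CornerModule.isEquivalence_functor hφ
  refine BoundedDerivedCategory.triangulatedEquivalent (CornerModule.functor φ) _ _
    (fun M hM => ?_) fun N hN => ?_
  · have : Module.Finite S M := hM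
    exact CornerModule.finite hφ
  · have : Module.Finite A N := hN
    let M := (CornerModule.functor φ).objPreimage N
    let i := (CornerModule.functor φ).objObjPreimageIso N
    have : Module.Finite A (CornerModule φ M) := Module.Finite.equiv i.toLinearEquiv.symm
    exact ⟨M, CornerModule.finite_of_finite hφ, ⟨i⟩⟩

end Morita

/-! ### Generators, relations and universal property of Λ^q. -/

section Generators

variable {n : ℕ} (q : Fin (n + 1) → ℂˣ)

namespace MultPreproj

/-- The image of an arrow in `Λ^q(Ã_n)`. -/
noncomputable def arr (a : CyclicArrow n) : MultPreproj q := mk q (pathArrow a)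

lemma e_mul_self (i : Fin (n + 1)) : e q i * e q i = e q i := isIdempotentElem_e q i

lemma e_mul_e_of_ne {i j : Fin (n + 1)} (h : i ≠ j) : e q i * e q j = 0 := by
  have := RingQuot.mkAlgHom_rel ℂ
    (PathAlgebra.Rel.orth (k := ℂ) (s := CyclicArrow.source (n := n)) (t := CyclicArrow.target) i j h)
  rw [map_mul, map_zero] at this
  rw [e, e, ← map_mul]
  exact (congrArg (mk q) this).trans (map_zero _)

lemma sum_e : ∑ i, e q i = 1 := by
  have := RingQuot.mkAlgHom_rel ℂ
    (PathAlgebra.Rel.complete (k := ℂ) (s := CyclicArrow.source (n := n)) (t := CyclicArrow.target))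
  rw [map_sum, map_one] at this
  simp only [e]
  rw [← map_sum]
  exact (congrArg (mk q) this).trans (map_one _)

lemma e_target_mul_arr (a : CyclicArrow n) : e q a.target * arr q a = arr q a := by
  have := RingQuot.mkAlgHom_rel ℂ
    (PathAlgebra.Rel.target (k := ℂ) (s := CyclicArrow.source (n := n)) (t := CyclicArrow.target) a)
  rw [map_mul] at this
  rw [e, arr, ← map_mul]
  exact congrArg (mk q) this

lemma arr_mul_e_source (a : CyclicArrow n) : arr q a * e q a.source = arr q a := by
  have := RingQuot.mkAlgHom_rel ℂ
    (PathAlgebra.Rel.source (k := ℂ) (s := CyclicArrow.source (n := n)) (t := CyclicArrow.target) a)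
  rw [map_mul] at this
  rw [e, arr, ← map_mul]
  exact congrArg (mk q) this

/-- The arrow `α_i`. -/
noncomputable abbrev al (i : Fin (n + 1)) : MultPreproj q := arr q (.alpha i)

/-- The arrow `α_i^*`. -/
noncomputable abbrev als (i : Fin (n + 1)) : MultPreproj q := arr q (.alphaStar i)

lemma e_mul_al (i : Fin (n + 1)) : e q (i + 1) * al q i = al q i := e_target_mul_arr q (.alpha i)

lemma al_mul_e (i : Fin (n + 1)) : al q i * e q i = al q i := arr_mul_e_source q (.alpha i)

lemma e_mul_als (i : Fin (n + 1)) : e q i * als q i = als q i := e_target_mul_arr q (.alphaStar i)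

lemma als_mul_e (i : Fin (n + 1)) : als q i * e q (i + 1) = als q i :=
  arr_mul_e_source q (.alphaStar i)

lemma z_mul_zInv : arr q .z * arr q .zInv = e q (Fin.last n) := by
  rw [arr, arr, ← map_mul]
  exact RingQuot.mkAlgHom_rel ℂ (MultPreprojRel.z_mul_zInv (q := q))

lemma zInv_mul_z : arr q .zInv * arr q .z = e q (Fin.last n) := by
  rw [arr, arr, ← map_mul]
  exact RingQuot.mkAlgHom_rel ℂ (MultPreprojRel.zInv_mul_z (q := q))

lemma z_eq : arr q .z = e q (Fin.last n) + als q (Fin.last n) * al q (Fin.last n) := by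
  rw [al, als, arr, arr, arr, e, ← map_mul, ← map_add]
  exact RingQuot.mkAlgHom_rel ℂ (MultPreprojRel.z_eq (q := q))

/-- The defining relation is used at i + 1, so that the arrows on the left have index i and no
cyclic subtraction remains. -/
lemma vertex_relation (i : Fin (n + 1)) : e q (i + 1) + al q i * als q i =
    (q (i + 1) : ℂ) • (e q (i + 1) + als q (i + 1) * al q (i + 1)) := by
  have h := RingQuot.mkAlgHom_rel ℂ (MultPreprojRel.vertex (q := q) (i + 1))
  rw [add_sub_cancel_right] at h
  rw [smul_add, al, als, arr, arr, e, al, als, arr, arr, ← map_mul, ← map_mul, ← map_smul,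
    ← map_smul, ← map_add, ← map_add]
  exact h

lemma induction {p : MultPreproj q → Prop} (algebraMap : ∀ c : ℂ, p (algebraMap ℂ _ c))
    (e : ∀ i, p (e q i)) (arr : ∀ a, p (arr q a))
    (mul : ∀ x y, p x → p y → p (x * y)) (add : ∀ x y, p x → p y → p (x + y)) (x : MultPreproj q) :
    p x := by
  obtain ⟨x, rfl⟩ := RingQuot.mkAlgHom_surjective ℂ (MultPreprojRel q) x
  obtain ⟨x, rfl⟩ := RingQuot.mkAlgHom_surjective ℂ _ x
  change p (mk q _)
  induction x using FreeAlgebra.induction with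
  | grade0 c =>
    rw [AlgHom.commutes, AlgHom.commutes]
    exact algebraMap c
  | grade1 x =>
    cases x with
    | inl i => exact e i
    | inr a => exact arr a
  | mul x y hx hy =>
    rw [map_mul, map_mul]
    exact mul _ _ hx hy
  | add x y hx hy =>
    rw [map_add, map_add]
    exact add _ _ hx hy

/-- The universal property of `Λ^q(Ã_n)`. -/
noncomputable def lift {T : Type*} [Ring T] [Algebra ℂ T] (ε : Fin (n + 1) → T)
    (f : CyclicArrow n → T)
    (idem : ∀ i, ε i * ε i = ε i) (orth : ∀ i j, i ≠ j → ε i * ε j = 0) (complete : ∑ i, ε i = 1)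
    (target : ∀ a, ε a.target * f a = f a) (source : ∀ a, f a * ε a.source = f a)
    (z_mul_zInv : f .z * f .zInv = ε (Fin.last n)) (zInv_mul_z : f .zInv * f .z = ε (Fin.last n))
    (z_eq : f .z = ε (Fin.last n) + f (.alphaStar (Fin.last n)) * f (.alpha (Fin.last n)))
    (vertex : ∀ i, ε (i + 1) + f (.alpha i) * f (.alphaStar i) =
      (q (i + 1) : ℂ) • ε (i + 1) + (q (i + 1) : ℂ) • (f (.alphaStar (i + 1)) * f (.alpha (i + 1)))) :
    MultPreproj q →ₐ[ℂ] T :=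
  RingQuot.liftAlgHom ℂ ⟨RingQuot.liftAlgHom ℂ ⟨FreeAlgebra.lift ℂ (Sum.elim ε f), by
    intro x y h
    induction h <;> simp_all [map_sum]⟩, by
    intro x y h
    have hv (i : Fin (n + 1)) := vertex (i - 1)
    simp only [sub_add_cancel] at hv
    induction h <;> simp_all [pathArrow, pathVertex, PathAlgebra.vertex, PathAlgebra.arrow]⟩

section
variable {T : Type*} [Ring T] [Algebra ℂ T] (ε : Fin (n + 1) → T) (f : CyclicArrow n → T)
  (h₁ h₂ h₃ h₄ h₅ h₆ h₇ h₈ h₉)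

@[simp] lemma lift_e (i : Fin (n + 1)) : lift q ε f h₁ h₂ h₃ h₄ h₅ h₆ h₇ h₈ h₉ (e q i) = ε i := by
  refine (RingQuot.liftAlgHom_mkAlgHom_apply ℂ _ _ _).trans ?_
  simp [PathAlgebra.vertex, pathVertex]

@[simp] lemma lift_arr (a : CyclicArrow n) :
    lift q ε f h₁ h₂ h₃ h₄ h₅ h₆ h₇ h₈ h₉ (arr q a) = f a := by
  refine (RingQuot.liftAlgHom_mkAlgHom_apply ℂ _ _ _).trans ?_
  simp [PathAlgebra.arrow, pathArrow]

end

end MultPreproj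

end Generators

/-! ### The partial products as a cyclic sequence. -/

section PartialProduct

variable {n : ℕ} (q : Fin (n + 1) → ℂˣ)

lemma partialProduct_last (hq : ∏ i, q i = 1) : partialProduct q (Fin.last n) = 1 := by
  rw [← hq, partialProduct]
  congr 1
  ext i
  simp [Fin.le_last]

lemma partialProduct_zero : partialProduct q 0 = q 0 := by
  have : Finset.Iic (0 : Fin (n + 1)) = {0} := by ext i; simp
  rw [partialProduct, this, Finset.prod_singleton]

lemma partialProduct_succ (i : Fin n) :
    partialProduct q i.succ = partialProduct q i.castSucc * q i.succ := by
  have : Finset.Iic i.succ = insert i.succ (Finset.Iic i.castSucc) := by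
    ext j
    simp only [Finset.mem_Iic, Finset.mem_insert, Fin.le_def, Fin.ext_iff, Fin.val_succ,
      Fin.val_castSucc]
    lia
  rw [partialProduct, this, Finset.prod_insert, mul_comm, partialProduct]
  simp [Fin.le_def]

/-- The total product being 1 is what makes the recursion survive the passage from the last vertex
to the first. -/
lemma partialProduct_add_one (hq : ∏ i, q i = 1) (i : Fin (n + 1)) :
    partialProduct q (i + 1) = partialProduct q i * q (i + 1) := by
  induction i using Fin.lastCases with
  | last => rw [partialProduct_last q hq, Fin.last_add_one, partialProduct_zero, one_mul]
  | cast i => rw [Fin.coeSucc_eq_succ, partialProduct_succ]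

/-- Induction around the cycle starts at the last vertex, where z is invertible and the corner is
taken. -/
lemma Fin.induction_cyclic {p : Fin (n + 1) → Prop} (last : p (Fin.last n))
    (succ : ∀ i, p i → p (i + 1)) (i : Fin (n + 1)) : p i := by
  induction i using Fin.induction with
  | zero => exact Fin.last_add_one n ▸ succ _ last
  | succ i hi => exact Fin.coeSucc_eq_succ (a := i) ▸ succ _ hi

end PartialProduct

/-! ### The central unit, and fullness of the last idempotent. -/

namespace MultPreproj

variable {n : ℕ} (q : Fin (n + 1) → ℂˣ)

/-- The scalar `Q_i`. -/
noncomputable abbrev Q (i : Fin (n + 1)) : ℂ := (partialProduct q i : ℂ)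

lemma Q_ne_zero (i : Fin (n + 1)) : Q q i ≠ 0 := (partialProduct q i).ne_zero

/-- The central element `∑ Q_i (e_i + α_i^* α_i)`. -/
noncomputable def central : MultPreproj q := ∑ i, Q q i • (e q i + als q i * al q i)

lemma central_mul_e (i : Fin (n + 1)) :
    central q * e q i = Q q i • (e q i + als q i * al q i) := by
  rw [central, Finset.sum_mul, Finset.sum_eq_single i]
  · rw [smul_mul_assoc, add_mul, e_mul_self, mul_assoc, al_mul_e]
  · intro j _ hj
    rw [smul_mul_assoc, add_mul, e_mul_e_of_ne q hj, mul_assoc, ← al_mul_e, mul_assoc (al q j),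
      e_mul_e_of_ne q hj, mul_zero, mul_zero, add_zero, smul_zero]
  · simp

lemma e_mul_central (i : Fin (n + 1)) :
    e q i * central q = Q q i • (e q i + als q i * al q i) := by
  rw [central, Finset.mul_sum, Finset.sum_eq_single i]
  · rw [mul_smul_comm, mul_add, e_mul_self, ← mul_assoc, e_mul_als]
  · intro j _ hj
    rw [mul_smul_comm, mul_add, e_mul_e_of_ne q hj.symm, ← mul_assoc, ← e_mul_als, ← mul_assoc,
      e_mul_e_of_ne q hj.symm, zero_mul, zero_mul, add_zero, smul_zero]
  · simp

section

variable (hq : ∏ i, q i = 1)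
include hq

/-- The vertex relation and Q_{i+1} = Q_i q_{i+1} give a second form of the component of c at i + 1,
with α_i α_i^* and the scalar of the preceding vertex. -/
lemma central_mul_e_add_one (i : Fin (n + 1)) :
    central q * e q (i + 1) = Q q i • (e q (i + 1) + al q i * als q i) := by
  rw [central_mul_e, vertex_relation, smul_smul, Q, partialProduct_add_one q hq, Units.val_mul]

lemma al_mul_als (i : Fin (n + 1)) :
    al q i * als q i = ((Q q i)⁻¹ • central q - 1) * e q (i + 1) := by
  rw [sub_mul, smul_mul_assoc, central_mul_e_add_one q hq, smul_smul,
    inv_mul_cancel₀ (Q_ne_zero q i), one_smul, one_mul, add_sub_cancel_left]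

omit hq in
lemma als_mul_al (i : Fin (n + 1)) :
    als q i * al q i = ((Q q i)⁻¹ • central q - 1) * e q i := by
  rw [sub_mul, smul_mul_assoc, central_mul_e q, smul_smul,
    inv_mul_cancel₀ (Q_ne_zero q i), one_smul, one_mul, add_sub_cancel_left]

lemma z_eq_central : arr q .z = central q * e q (Fin.last n) := by
  rw [central_mul_e, z_eq, Q, partialProduct_last q hq, Units.val_one, one_smul]

/-- The two forms of c fit together: c α_i = Q_i (e_{i+1} + α_i α_i^*) α_i = α_i Q_i (e_i + α_i^*
α_i) = α_i c, and similarly for α_i^*. At the last vertex c is z, so c z⁻¹ and z⁻¹ c are both the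
idempotent. -/
lemma central_commute (x : MultPreproj q) : Commute (central q) x := by
  have he (i : Fin (n + 1)) : Commute (central q) (e q i) :=
    (central_mul_e q i).trans (e_mul_central q i).symm
  induction x using induction with
  | algebraMap c => exact Algebra.commute_algebraMap_right c _
  | e i => exact he i
  | mul x y hx hy => exact hx.mul_right hy
  | add x y hx hy => exact hx.add_right hy
  | arr a =>
    cases a with
    | alpha i =>
      change central q * al q i = al q i * central q
      conv_lhs => rw [← e_mul_al, ← mul_assoc, central_mul_e_add_one q hq, smul_mul_assoc, add_mul,
        e_mul_al]
      conv_rhs => rw [← al_mul_e, mul_assoc, e_mul_central, mul_smul_comm, mul_add, al_mul_e,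
        ← mul_assoc]
    | alphaStar i =>
      change central q * als q i = als q i * central q
      conv_lhs => rw [← e_mul_als, ← mul_assoc, central_mul_e, smul_mul_assoc, add_mul,
        e_mul_als]
      conv_rhs => rw [← als_mul_e, mul_assoc, ← he, central_mul_e_add_one q hq, mul_smul_comm,
        mul_add, als_mul_e, ← mul_assoc]
    | z =>
      rw [z_eq_central q hq]
      exact (Commute.refl _).mul_right (he _)
    | zInv =>
      have h1 : arr q .zInv = e q (Fin.last n) * arr q .zInv := (e_target_mul_arr q .zInv).symm
      have h2 : arr q .zInv = arr q .zInv * e q (Fin.last n) := (arr_mul_e_source q .zInv).symm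
      change _ = _
      conv_lhs => rw [h1, ← mul_assoc, ← z_eq_central q hq, z_mul_zInv]
      conv_rhs => rw [h2, mul_assoc, ← he, ← z_eq_central q hq, zInv_mul_z]

lemma isUnit_central : IsUnit (central q) := by
  have h (i : Fin (n + 1)) : ∃ w, central q * w = e q i := by
    induction i using Fin.induction_cyclic with
    | last =>
      refine ⟨arr q .zInv, ?_⟩
      rw [← z_mul_zInv, z_eq_central q hq, mul_assoc]
      exact congrArg _ (e_target_mul_arr q .zInv).symm
    | succ i hi =>
      obtain ⟨w, hw⟩ := hi
      -- The analogue of (1 + xy)⁻¹ = 1 - x (1 + yx)⁻¹ y: an inverse of c at i is carried across the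
      -- arrow to i + 1.
      refine ⟨(Q q i)⁻¹ • e q (i + 1) - al q i * w * als q i, ?_⟩
      have h1 : al q i * als q i = al q i * (central q * w) * als q i := by rw [hw, al_mul_e]
      have h2 := al_mul_als q hq i
      rw [h1, ← mul_assoc, ← (central_commute q hq (al q i)).eq, sub_mul, one_mul] at h2
      rw [mul_sub, mul_smul_comm, ← smul_mul_assoc, ← mul_assoc, ← mul_assoc, h2, sub_sub_cancel]
  choose w hw using h
  have h1 : central q * ∑ i, w i = 1 := by
    rw [Finset.mul_sum, Finset.sum_congr rfl fun i _ => hw i, sum_e]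
  exact ⟨⟨central q, ∑ i, w i, h1, by rw [← (central_commute q hq _).eq, h1]⟩, rfl⟩

end

lemma aeval_central_commute (hq : ∏ i, q i = 1) (p : Polynomial ℂ) (x : MultPreproj q) :
    Commute (Polynomial.aeval (central q) p) x := by
  induction p using Polynomial.induction_on' with
  | add p r hp hr => rw [map_add]; exact hp.add_left hr
  | monomial k c =>
    rw [Polynomial.aeval_monomial]
    exact (Algebra.commute_algebraMap_left c x).mul_left ((central_commute q hq x).pow_left k)

/-- If the `Q_i` are distinct then `e_{n+1}` generates `Λ^q(Ã_n)` as a two-sided ideal. -/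
lemma one_mem_span_e_last (hq : ∏ i, q i = 1) (hQ : Function.Injective (Q q)) :
    (1 : MultPreproj q) ∈ TwoSidedIdeal.span {e q (Fin.last n)} := by
  let J := TwoSidedIdeal.span {e q (Fin.last n)}
  let f : Polynomial ℂ →ₐ[ℂ] MultPreproj q := Polynomial.aeval (central q)
  -- The polynomials in c that push e_i into J form an ideal because c is central; the claim thus
  -- becomes a coprimality question in ℂ[X].
  let I (i : Fin (n + 1)) : Ideal (Polynomial ℂ) :=
    { carrier := {p | f p * e q i ∈ J}
      add_mem' := fun {a b} ha hb => by
        change f (a + b) * _ ∈ J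
        rw [map_add, add_mul]
        exact J.add_mem ha hb
      zero_mem' := by
        change f 0 * _ ∈ J
        rw [map_zero, zero_mul]
        exact J.zero_mem
      smul_mem' := fun c x hx => by
        change f (c * x) * _ ∈ J
        rw [map_mul, mul_assoc]
        exact J.mul_mem_left _ _ hx }
  let L (i : Fin (n + 1)) : Polynomial ℂ := Polynomial.X - Polynomial.C (Q q i)
  have hf (p x) : f p * x = x * f p := aeval_central_commute q hq p x
  have hL (i) : f (L i) = Q q i • ((Q q i)⁻¹ • central q - 1) := by
    rw [smul_sub, smul_smul, mul_inv_cancel₀ (Q_ne_zero q i), one_smul]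
    simp only [L, f, map_sub, Polynomial.aeval_X, Polynomial.aeval_C, Algebra.algebraMap_eq_smul_one]
  have smul_mem (c : ℂ) (x) (hx : x ∈ J) : c • x ∈ J := by
    rw [Algebra.smul_def]
    exact J.mul_mem_left _ _ hx
  -- Conjugating p(c) e_i by α_i and α_i^* multiplies it by α_i α_i^*, which is `L i` evaluated at c
  -- up to the scalar Q_i.
  have up (i p) (hp : p ∈ I i) : L i * p ∈ I (i + 1) := by
    have : al q i * (f p * e q i) * als q i ∈ J := J.mul_mem_right _ _ (J.mul_mem_left _ _ hp)
    rw [← mul_assoc, ← hf, mul_assoc (f p), al_mul_e, mul_assoc, al_mul_als q hq] at this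
    change f (L i * p) * _ ∈ J
    rw [map_mul, ← hf, hL, mul_assoc, smul_mul_assoc, mul_smul_comm]
    exact smul_mem _ _ this
  have down (i p) (hp : p ∈ I (i + 1)) : L i * p ∈ I i := by
    have : als q i * (f p * e q (i + 1)) * al q i ∈ J :=
      J.mul_mem_right _ _ (J.mul_mem_left _ _ hp)
    rw [← mul_assoc, ← hf, mul_assoc (f p), als_mul_e, mul_assoc, als_mul_al] at this
    change f (L i * p) * _ ∈ J
    rw [map_mul, ← hf, hL, mul_assoc, smul_mul_assoc, mul_smul_comm]
    exact smul_mem _ _ this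
  have one_mem : (1 : Polynomial ℂ) ∈ I (Fin.last n) := by
    change f 1 * _ ∈ J
    rw [map_one, one_mul]
    exact TwoSidedIdeal.subset_span rfl
  -- Walking backwards from the last vertex to i collects one factor for each edge crossed.
  have hprod (i) : ∏ j ∈ Finset.Ico i (Fin.last n), L j ∈ I i := by
    induction i using Fin.reverseInduction with
    | last => simpa using one_mem
    | cast i hi =>
      have : Finset.Ico i.castSucc (Fin.last n) =
          insert i.castSucc (Finset.Ico i.succ (Fin.last n)) := by
        ext j
        simp only [Finset.mem_Ico, Finset.mem_insert, Fin.le_def, Fin.lt_def, Fin.ext_iff,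
          Fin.val_succ, Fin.val_castSucc, Fin.val_last]
        lia
      rw [this, Finset.prod_insert (by simp [Fin.le_def])]
      exact down _ _ (by rwa [Fin.coeSucc_eq_succ])
  have key (i) : (1 : Polynomial ℂ) ∈ I i := by
    induction i using Fin.induction_cyclic with
    | last => exact one_mem
    | succ i hi =>
      have h1 : L i ∈ I (i + 1) := by simpa using up i 1 hi
      -- The factor of the one edge crossed going forward never occurs among those collected going
      -- backward. If i is the last vertex, then i + 1 = 0 and the half-open interval still omits i.
      have hc : IsCoprime (L i) (∏ j ∈ Finset.Ico (i + 1) (Fin.last n), L j) := by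
        refine IsCoprime.prod_right fun j hj => Polynomial.pairwise_coprime_X_sub_C hQ ?_
        rintro rfl
        induction i using Fin.lastCases with
        | last => simp at hj
        | cast i => simp [Fin.coeSucc_eq_succ, Fin.le_def] at hj
      obtain ⟨u, v, huv⟩ := hc
      rw [← huv]
      exact (I (i + 1)).add_mem ((I _).mul_mem_left _ h1) ((I _).mul_mem_left _ (hprod _))
  rw [← sum_e q]
  refine sum_mem fun i _ => ?_
  have h : f 1 * e q i ∈ J := key i
  rwa [map_one, one_mul] at h

/-- The inclusion of the corner at `e_{n+1}`, on opposite rings. -/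
noncomputable def cornerInclusion : (Corner q)ᵐᵒᵖ →ₙ+* (MultPreproj q)ᵐᵒᵖ where
  toFun x := .op x.unop.1
  map_mul' _ _ := rfl
  map_add' _ _ := rfl
  map_zero' := rfl

lemma isFullCorner_cornerInclusion (hq : ∏ i, q i = 1) (hQ : Function.Injective (Q q)) :
    IsFullCorner (cornerInclusion q) where
  injective x y h := MulOpposite.unop_injective (Subtype.ext (MulOpposite.op_injective h))
  exists_eq s := ⟨.op ⟨e q (Fin.last n) * s.unop * e q (Fin.last n), ⟨s.unop, rfl⟩⟩, by
    apply MulOpposite.unop_injective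
    exact mul_assoc _ _ _⟩
  full := by
    have h := TwoSidedIdeal.mem_span_iff_mem_addSubgroup_closure.1 (one_mem_span_e_last q hq hQ)
    suffices H : ∀ w ∈ AddSubgroup.closure _, ∃ (m : ℕ) (x y : Fin m → (MultPreproj q)ᵐᵒᵖ),
        ∑ i, x i * cornerInclusion q 1 * y i = .op w from H _ h
    intro w hw
    induction hw using AddSubgroup.closure_induction with
    | mem w hw =>
      obtain ⟨_, ⟨u, -, _, rfl, rfl⟩, v, -, rfl⟩ := hw
      -- The generator u e v of the ideal reads v e u in the opposite ring.
      refine ⟨1, fun _ => .op v, fun _ => .op u, ?_⟩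
      rw [Fin.sum_univ_one]
      exact mul_assoc _ _ _
    | zero => exact ⟨0, Fin.elim0, Fin.elim0, rfl⟩
    | add a b _ _ ha hb =>
      obtain ⟨m, x, y, h⟩ := ha
      obtain ⟨m', x', y', h'⟩ := hb
      refine ⟨m + m', Fin.append x x', Fin.append y y', ?_⟩
      rw [Fin.sum_univ_add]
      simp only [Fin.append_left, Fin.append_right, h, h', MulOpposite.op_add]
    | neg a _ ha =>
      obtain ⟨m, x, y, h⟩ := ha
      refine ⟨m, fun i => -x i, y, ?_⟩
      simp only [neg_mul, Finset.sum_neg_distrib, h, MulOpposite.op_neg]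

end MultPreproj

/-! ### Laurent polynomials evaluated at a unit. -/

section Laurent

open LaurentPolynomial

variable {k A : Type*} [CommSemiring k] [Semiring A] [Algebra k A]

/-- The evaluation of Laurent polynomials at a unit of a possibly noncommutative algebra. -/
noncomputable def LaurentPolynomial.evalUnit (v : Aˣ) : k[T;T⁻¹] →ₐ[k] A :=
  AddMonoidAlgebra.lift k A ℤ ((Units.coeHom A).comp (zpowersHom _ v))

lemma LaurentPolynomial.evalUnit_T (v : Aˣ) (m : ℤ) :
    evalUnit (k := k) v (T m) = ((v ^ m : Aˣ) : A) := by
  refine (AddMonoidAlgebra.lift_single (R := k) _ m (1 : k)).trans ?_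
  rw [one_smul]
  rfl

lemma LaurentPolynomial.algHom_ext_T {f g : k[T;T⁻¹] →ₐ[k] A} (h : f (T 1) = g (T 1)) : f = g := by
  have : (f : k[T;T⁻¹] →* A).comp (AddMonoidAlgebra.of k ℤ) =
      (g : k[T;T⁻¹] →* A).comp (AddMonoidAlgebra.of k ℤ) := MonoidHom.ext_mint h
  exact AddMonoidAlgebra.algHom_ext (fun m => DFunLike.congr_fun this (Multiplicative.ofAdd m))
    (Algebra.ext_id ..)

lemma LaurentPolynomial.C_smul {R : Type*} [CommSemiring R] [Algebra k R] (c : k)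
    (r : R) : (C (c • r) : R[T;T⁻¹]) = c • C r :=
  (AddMonoidAlgebra.smul_single ..).symm

lemma LaurentPolynomial.aeval_T_one (P : Polynomial k) :
    Polynomial.aeval (T 1 : k[T;T⁻¹]) P = Polynomial.toLaurent P := by
  rw [← Polynomial.coe_toLaurentAlg]
  congr 1
  exact Polynomial.algHom_ext (by simp)

end Laurent

/-! ### Algebras spanned by powers of x and y with xy a coefficient. -/

section SignedMonomials

open LaurentPolynomial

variable {R : Type*} [CommRing R] {A B : Type*} [Ring A] [Ring B]

/-- The `k`-th power of `x` for `k ≥ 0`, and the `-k`-th power of `y` for `k < 0`. -/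
def signedPow (x y : A) (k : ℤ) : A := if 0 ≤ k then x ^ k.toNat else y ^ (-k).toNat

lemma signedPow_natCast (x y : A) (m : ℕ) : signedPow x y m = x ^ m := by
  simp [signedPow]

lemma signedPow_neg_natCast (x y : A) (m : ℕ) : signedPow x y (-m) = y ^ m := by
  rcases m with _ | m
  · simp [signedPow]
  · rw [signedPow, if_neg (by lia)]
    congr 1

/-- The additive map `∑ r_k X^k ↦ ∑ r_k x^k + ∑ r_{-k} y^k`. -/
noncomputable def signedEval (ζ : R →+* A) (x y : A) : (ℤ →₀ R) →+ A :=
  Finsupp.liftAddHom fun k => (AddMonoidHom.mulRight (signedPow x y k)).comp ζ.toAddMonoidHom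

lemma signedEval_single (ζ : R →+* A) (x y : A) (k : ℤ) (r : R) :
    signedEval ζ x y (Finsupp.single k r) = ζ r * signedPow x y k :=
  Finsupp.liftAddHom_apply_single _ _ _

lemma map_signedEval (ζ : R →+* A) (x y : A) (θ : A →+* B) (h : ℤ →₀ R) :
    θ (signedEval ζ x y h) = signedEval (θ.comp ζ) (θ x) (θ y) h := by
  induction h using Finsupp.induction_linear with
  | zero => simp
  | add f g hf hg => rw [map_add, map_add, map_add, hf, hg]
  | single k r =>
    rw [signedEval_single, signedEval_single, map_mul, signedPow, signedPow]
    split_ifs <;> simp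

lemma closure_le_range_signedEval (ζ : R →+* A) (x y : A) :
    AddSubgroup.closure {w | ∃ (r : R) (m : ℕ), w = ζ r * x ^ m ∨ w = ζ r * y ^ m} ≤
      (signedEval ζ x y).range := by
  rw [AddSubgroup.closure_le]
  rintro _ ⟨r, m, rfl | rfl⟩
  · exact ⟨Finsupp.single m r, by rw [signedEval_single, signedPow_natCast]⟩
  · exact ⟨Finsupp.single (-m) r, by rw [signedEval_single, signedPow_neg_natCast]⟩

/-- The monomial of index k lands in degree d k, with a power of p as coefficient. Degrees are
distinct as d ≠ 0, and powers of p cancel in a domain. -/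
lemma signedEval_injective [IsDomain R] (p : R) (hp : p ≠ 0) (d : ℕ) (hd : d ≠ 0) :
    Function.Injective (signedEval (C : R →+* R[T;T⁻¹]) (T d) (C p * T (-d))) := by
  have hpow (k : ℤ) : signedPow (T d : R[T;T⁻¹]) (C p * T (-d)) k =
      C (p ^ (-k).toNat) * T (d * k) := by
    rcases k.eq_nat_or_neg with ⟨m, rfl | rfl⟩
    · rw [signedPow_natCast, T_pow]
      simp [mul_comm]
    · rw [signedPow_neg_natCast, mul_pow, T_pow, map_pow]
      congr 2
      · simp
      · ring
  rw [injective_iff_map_eq_zero]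
  intro h hh
  have key (h : ℤ →₀ R) (j : ℤ) :
      (signedEval (C : R →+* R[T;T⁻¹]) (T d) (C p * T (-d)) h).coeff (d * j) =
        h j * p ^ (-j).toNat := by
    induction h using Finsupp.induction_linear with
    | zero => simp
    | add f g hf hg =>
      rw [map_add, AddMonoidAlgebra.coeff_add, Finsupp.add_apply, hf, hg, Finsupp.add_apply, add_mul]
    | single k r =>
      rw [signedEval_single, hpow, ← mul_assoc, ← map_mul, ← single_eq_C_mul_T,
        AddMonoidAlgebra.coeff_single, Finsupp.single_apply, Finsupp.single_apply]
      by_cases hkj : k = j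
      · rw [if_pos hkj, if_pos (by rw [hkj]), hkj]
      · rw [if_neg hkj, if_neg (by simpa [hd] using hkj), zero_mul]
  ext j
  have := key h j
  rw [hh, AddMonoidAlgebra.coeff_zero, Finsupp.zero_apply, eq_comm] at this
  exact (mul_eq_zero.1 this).resolve_right (pow_ne_zero _ hp)

/-- A factor x either lengthens a power of x or cancels one y of a power of y, leaving the
coefficient p. -/
lemma mul_mem_closure_signed {A : Type*} [CommRing A] (ζ : R →+* A) (x y : A) (p : R)
    (h : x * y = ζ p) {w : A}
    (hw : w ∈ AddSubgroup.closure {w | ∃ (r : R) (m : ℕ), w = ζ r * x ^ m ∨ w = ζ r * y ^ m}) :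
    w * x ∈ AddSubgroup.closure {w | ∃ (r : R) (m : ℕ), w = ζ r * x ^ m ∨ w = ζ r * y ^ m} := by
  induction hw using AddSubgroup.closure_induction with
  | mem w hw =>
    obtain ⟨r, m, rfl | rfl⟩ := hw
    · exact AddSubgroup.subset_closure ⟨r, m + 1, .inl (by ring)⟩
    · rcases m with _ | m
      · exact AddSubgroup.subset_closure ⟨r, 1, .inl (by ring)⟩
      · exact AddSubgroup.subset_closure ⟨r * p, m, .inr (by rw [map_mul, ← h]; ring)⟩
  | zero => rw [zero_mul]; exact zero_mem _
  | add a b _ _ ha hb => rw [add_mul]; exact add_mem ha hb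
  | neg a _ ha => rw [neg_mul]; exact neg_mem ha

lemma closure_signed_comm (ζ : R →+* A) (x y : A) :
    {w | ∃ (r : R) (m : ℕ), w = ζ r * x ^ m ∨ w = ζ r * y ^ m} =
      {w | ∃ (r : R) (m : ℕ), w = ζ r * y ^ m ∨ w = ζ r * x ^ m} := by
  simp only [or_comm]

lemma coeff_mul_mem_closure_signed {A : Type*} [CommRing A] (ζ : R →+* A) (c : R) {w : A} (x y : A)
    (hw : w ∈ AddSubgroup.closure {w | ∃ (r : R) (m : ℕ), w = ζ r * x ^ m ∨ w = ζ r * y ^ m}) :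
    ζ c * w ∈ AddSubgroup.closure {w | ∃ (r : R) (m : ℕ), w = ζ r * x ^ m ∨ w = ζ r * y ^ m} := by
  induction hw using AddSubgroup.closure_induction with
  | mem w hw =>
    obtain ⟨r, m, rfl | rfl⟩ := hw
    · exact AddSubgroup.subset_closure ⟨c * r, m, .inl (by rw [map_mul, mul_assoc])⟩
    · exact AddSubgroup.subset_closure ⟨c * r, m, .inr (by rw [map_mul, mul_assoc])⟩
  | zero => rw [mul_zero]; exact zero_mem _
  | add a b _ _ ha hb => rw [mul_add]; exact add_mem ha hb
  | neg a _ ha => rw [mul_neg]; exact neg_mem ha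

/-- If `x * y` is a coefficient then any ring element built from coefficients, `x` and `y` is a sum
of signed monomials. -/
lemma signedEval_surjective_of_mul_eq {A : Type*} [CommRing A] (ζ : R →+* A) (x y : A) (p : R)
    (h : x * y = ζ p) (hgen : ∀ S : Subring A, (∀ r, ζ r ∈ S) → x ∈ S → y ∈ S → S = ⊤) :
    Function.Surjective (signedEval ζ x y) := by
  let W := AddSubgroup.closure {w | ∃ (r : R) (m : ℕ), w = ζ r * x ^ m ∨ w = ζ r * y ^ m}
  have one_mem : (1 : A) ∈ W := AddSubgroup.subset_closure ⟨1, 0, .inl (by simp)⟩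
  -- The multipliers preserving W form a subring, which contains the generators; applying a
  -- multiplier to 1 ∈ W puts it in W.
  let S : Subring A :=
    { carrier := {u | ∀ w ∈ W, w * u ∈ W}
      mul_mem' := fun {a b} ha hb w hw => by
        rw [← mul_assoc]
        exact hb _ (ha _ hw)
      one_mem' := fun w hw => by rwa [mul_one]
      add_mem' := fun {a b} ha hb w hw => by
        rw [mul_add]
        exact add_mem (ha w hw) (hb w hw)
      zero_mem' := fun w hw => by
        rw [mul_zero]
        exact zero_mem _
      neg_mem' := fun {a} ha w hw => by
        rw [mul_neg]
        exact neg_mem (ha w hw) }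
  have hζ (r : R) : ζ r ∈ S := fun w hw => by
    rw [mul_comm]
    exact coeff_mul_mem_closure_signed ζ r x y hw
  have hS : S = ⊤ := by
    refine hgen S hζ (fun w hw => mul_mem_closure_signed ζ x y p h hw) fun w hw => ?_
    have hw' : w ∈ W := hw
    simp only [W] at hw' ⊢
    rw [closure_signed_comm] at hw' ⊢
    exact mul_mem_closure_signed ζ y x p (by rw [mul_comm, h]) hw'
  intro w
  have hw : w ∈ S := hS ▸ Subring.mem_top w
  have := hw 1 one_mem
  rw [one_mul] at this
  exact closure_le_range_signedEval ζ x y this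

/-- The freedom to rescale y by a unit is needed because P equals the product of the normalised
linear factors only up to a constant. -/
lemma signedEval_surjective_of_unit_mul {A : Type*} [CommRing A] (ζ : R →+* A) (x y : A) (p c c' : R)
    (hc : c' * c = 1)
    (h : x * y = ζ p) (hgen : ∀ S : Subring A, (∀ r, ζ r ∈ S) → x ∈ S → y ∈ S → S = ⊤) :
    Function.Surjective (signedEval ζ x (ζ c * y)) := by
  refine signedEval_surjective_of_mul_eq ζ x (ζ c * y) (c * p) ?_ fun S hζ hx hy => hgen S hζ hx ?_
  · rw [mul_left_comm, h, map_mul]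
  · have := S.mul_mem (hζ c') hy
    rwa [← mul_assoc, ← map_mul, hc, map_one, one_mul] at this

/-- Two algebras mapping to the same algebra, each with compatible signed monomials generating it
additively and independent in the target, are isomorphic. -/
lemma nonempty_algEquiv_of_signedEval {k S A₁ A₂ : Type*} [CommRing k] [CommRing S] [Algebra k S]
    [Ring A₁] [Ring A₂] [Algebra k A₁] [Algebra k A₂] (θ₁ : A₁ →ₐ[k] S) (θ₂ : A₂ →ₐ[k] S)
    (ζ₁ : R →+* A₁) (ζ₂ : R →+* A₂)
    (x₁ y₁ : A₁) (x₂ y₂ : A₂) (h₁ : Function.Surjective (signedEval ζ₁ x₁ y₁))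
    (h₂ : Function.Surjective (signedEval ζ₂ x₂ y₂)) (ζ : R →+* S) (x y : S)
    (hinj : Function.Injective (signedEval ζ x y))
    (hζ₁ : ∀ r, θ₁ (ζ₁ r) = ζ r) (hx₁ : θ₁ x₁ = x) (hy₁ : θ₁ y₁ = y)
    (hζ₂ : ∀ r, θ₂ (ζ₂ r) = ζ r) (hx₂ : θ₂ x₂ = x) (hy₂ : θ₂ y₂ = y) :
    Nonempty (A₁ ≃ₐ[k] A₂) := by
  have e₁ (h) : θ₁ (signedEval ζ₁ x₁ y₁ h) = signedEval ζ x y h := by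
    rw [← hx₁, ← hy₁, ← RingHom.ext (f := (θ₁ : A₁ →+* S).comp ζ₁) hζ₁]
    exact map_signedEval ζ₁ x₁ y₁ (θ₁ : A₁ →+* S) h
  have e₂ (h) : θ₂ (signedEval ζ₂ x₂ y₂ h) = signedEval ζ x y h := by
    rw [← hx₂, ← hy₂, ← RingHom.ext (f := (θ₂ : A₂ →+* S).comp ζ₂) hζ₂]
    exact map_signedEval ζ₂ x₂ y₂ (θ₂ : A₂ →+* S) h
  have i₁ : Function.Injective θ₁ := by
    rw [injective_iff_map_eq_zero]
    intro a ha
    obtain ⟨h, rfl⟩ := h₁ a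
    rw [e₁, map_eq_zero_iff _ hinj] at ha
    rw [ha, map_zero]
  have i₂ : Function.Injective θ₂ := by
    rw [injective_iff_map_eq_zero]
    intro a ha
    obtain ⟨h, rfl⟩ := h₂ a
    rw [e₂, map_eq_zero_iff _ hinj] at ha
    rw [ha, map_zero]
  -- Both images are the set of values of the signed evaluation in the common target.
  have hr : θ₁.range = θ₂.range := by
    apply le_antisymm
    · rintro _ ⟨a, rfl⟩
      obtain ⟨h, rfl⟩ := h₁ a
      exact ⟨signedEval ζ₂ x₂ y₂ h, (e₂ h).trans (e₁ h).symm⟩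
    · rintro _ ⟨a, rfl⟩
      obtain ⟨h, rfl⟩ := h₂ a
      exact ⟨signedEval ζ₁ x₁ y₁ h, (e₁ h).trans (e₂ h).symm⟩
  exact ⟨(AlgEquiv.ofInjective θ₁ i₁).trans
    ((Subalgebra.equivOfEq _ _ hr).trans (AlgEquiv.ofInjective θ₂ i₂).symm)⟩

section Hyperbola

variable (k : Type*) [CommRing k] [Algebra k R] (p : R)

/-- The ring `R[X, Y] / (p - XY)`. -/
abbrev HyperbolaRing : Type _ :=
  MvPolynomial (Fin 2) R ⧸ Ideal.span
    {(MvPolynomial.C p : MvPolynomial (Fin 2) R) - MvPolynomial.X 0 * MvPolynomial.X 1}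

namespace HyperbolaRing

noncomputable def coeffs : R →+* HyperbolaRing p :=
  (Ideal.Quotient.mk _).comp MvPolynomial.C

noncomputable def x (i : Fin 2) : HyperbolaRing p := Ideal.Quotient.mk _ (MvPolynomial.X i)

lemma x_zero_mul_x_one : x p 0 * x p 1 = coeffs p p := by
  have := Ideal.Quotient.eq_zero_iff_mem.2 (Ideal.mem_span_singleton_self
    ((MvPolynomial.C p : MvPolynomial (Fin 2) R) - MvPolynomial.X 0 * MvPolynomial.X 1))
  rw [map_sub, sub_eq_zero, map_mul] at this
  exact this.symm

/-- `R[X, Y] / (p - XY)` is additively generated by the `r X^m` and `r Y^m`. -/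
lemma signedEval_surjective (c c' : R) (hc : c' * c = 1) :
    Function.Surjective (signedEval (coeffs p) (x p 0) (coeffs p c * x p 1)) := by
  refine signedEval_surjective_of_unit_mul (coeffs p) (x p 0) (x p 1) p c c' hc
    (x_zero_mul_x_one p) fun S hζ h0 h1 => ?_
  rw [eq_top_iff]
  rintro w -
  obtain ⟨w, rfl⟩ := Ideal.Quotient.mk_surjective w
  induction w using MvPolynomial.induction_on with
  | C r => exact hζ r
  | add a b ha hb => exact S.add_mem ha hb
  | mul_X a i ha =>
    rw [map_mul]
    refine S.mul_mem ha ?_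
    fin_cases i
    exacts [h0, h1]

section lift

variable {k p} {S : Type*} [CommRing S] [Algebra k S]

noncomputable def lift (f : R →ₐ[k] S) (u v : S) (h : u * v = f p) : HyperbolaRing p →ₐ[k] S :=
  Ideal.Quotient.liftₐ _ (MvPolynomial.aevalTower f ![u, v]) (by
    refine fun a ha => (Ideal.span_le (I := RingHom.ker _)).2 ?_ ha
    rintro _ rfl
    rw [SetLike.mem_coe, RingHom.mem_ker]
    change MvPolynomial.aevalTower f ![u, v]
      (MvPolynomial.C p - MvPolynomial.X 0 * MvPolynomial.X 1) = 0
    rw [map_sub, map_mul, MvPolynomial.aevalTower_X, MvPolynomial.aevalTower_X,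
      MvPolynomial.aevalTower_C, ← h]
    exact sub_self _)

variable (f : R →ₐ[k] S) (u v : S) (h : u * v = f p)

lemma lift_coeffs (r : R) : lift f u v h (coeffs p r) = f r :=
  (Ideal.Quotient.liftₐ_apply _ _ _ _).trans (MvPolynomial.aevalTower_C _ _ _)

lemma lift_x_zero : lift f u v h (x p 0) = u :=
  (Ideal.Quotient.liftₐ_apply _ _ _ _).trans (MvPolynomial.aevalTower_X _ _ _)

lemma lift_x_one : lift f u v h (x p 1) = v :=
  (Ideal.Quotient.liftₐ_apply _ _ _ _).trans (MvPolynomial.aevalTower_X _ _ _)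

lemma hom_ext {f g : HyperbolaRing p →+* S} (hc : ∀ r, f (coeffs p r) = g (coeffs p r))
    (h0 : f (x p 0) = g (x p 0)) (h1 : f (x p 1) = g (x p 1)) : f = g := by
  refine Ideal.Quotient.ringHom_ext (MvPolynomial.ringHom_ext hc fun i => ?_)
  fin_cases i
  exacts [h0, h1]

end lift

/-- `X ↦ T^d`, `Y ↦ p T^{-d}`. -/
noncomputable def toLaurent (d : ℕ) : HyperbolaRing p →ₐ[k] R[T;T⁻¹] :=
  lift (Algebra.algHom k R R[T;T⁻¹]) (T d) (C p * T (-d)) (by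
    rw [mul_left_comm, ← T_add, add_neg_cancel, T_zero, mul_one]
    rfl)

lemma toLaurent_coeffs (d : ℕ) (r) : toLaurent k p d (coeffs p r) = C r := lift_coeffs ..

lemma toLaurent_x_zero (d : ℕ) : toLaurent k p d (x p 0) = T d := lift_x_zero ..

lemma toLaurent_x_one (d : ℕ) : toLaurent k p d (x p 1) = C p * T (-d) := lift_x_one ..

/-- The coefficients as an algebra map. -/
noncomputable def coeffsAlg : R →ₐ[k] HyperbolaRing p :=
  { coeffs p with commutes' := fun _ => rfl }

/-- A characterisation of `R[X, Y] / (p - XY)` up to isomorphism. -/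
lemma nonempty_algEquiv [IsDomain R] {A : Type*} [Ring A] [Algebra k A] (θ : A →ₐ[k] R[T;T⁻¹])
    (ζ : R →+* A) (xA yA : A) (h : Function.Surjective (signedEval ζ xA yA)) (d : ℕ) (hd : d ≠ 0)
    (p' c c' : R) (hc : c' * c = 1) (hp : c * p = p') (hp0 : p ≠ 0)
    (hζ : ∀ r, θ (ζ r) = C r) (hx : θ xA = T d) (hy : θ yA = C p' * T (-d)) :
    Nonempty (A ≃ₐ[k] HyperbolaRing p) := by
  refine nonempty_algEquiv_of_signedEval θ (toLaurent k p d) ζ (coeffs p) xA yA (x p 0)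
    (coeffs p c * x p 1) h (signedEval_surjective p c c' hc) C (T d) (C p' * T (-d))
    (signedEval_injective p' ?_ d hd) hζ hx hy (toLaurent_coeffs k p d) (toLaurent_x_zero k p d) ?_
  · rintro rfl
    apply hp0
    rw [← one_mul p, ← hc, mul_assoc, hp, mul_zero]
  · rw [map_mul, toLaurent_coeffs, toLaurent_x_one, ← mul_assoc, ← map_mul, hp]

end HyperbolaRing

end Hyperbola

end SignedMonomials


/-! ### Multiples of 1 modulo n + 1. -/

lemma Fin.nsmul_one_eq_zero_iff (n m : ℕ) : m • (1 : Fin (n + 1)) = 0 ↔ n + 1 ∣ m := by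
  rw [← ZMod.natCast_eq_zero_iff, ← nsmul_one]
  rfl

lemma Fin.val_nsmul_one {n : ℕ} (k : Fin (n + 1)) : (k : ℕ) • (1 : Fin (n + 1)) = k :=
  (nsmul_one (A := ZMod (n + 1)) _).trans (ZMod.natCast_zmod_val (n := n + 1) k)

/-! ### Spanning Λ^q by monomials over its central Laurent polynomials. -/

namespace MultPreproj

open LaurentPolynomial

variable {n : ℕ} (q : Fin (n + 1) → ℂˣ)

/-- The sum of the arrows `α_i`. -/
noncomputable def a : MultPreproj q := ∑ i, al q i

/-- The sum of the arrows `α_i^*`. -/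
noncomputable def b : MultPreproj q := ∑ i, als q i

lemma e_mul_a (i : Fin (n + 1)) : e q (i + 1) * a q = al q i := by
  rw [a, Finset.mul_sum, Finset.sum_eq_single i, e_mul_al]
  · intro j _ hj
    rw [← e_mul_al, ← mul_assoc, e_mul_e_of_ne q (by simpa using hj.symm), zero_mul]
  · simp

lemma a_mul_e (i : Fin (n + 1)) : a q * e q i = al q i := by
  rw [a, Finset.sum_mul, Finset.sum_eq_single i, al_mul_e]
  · intro j _ hj
    rw [← al_mul_e, mul_assoc, e_mul_e_of_ne q hj, mul_zero]
  · simp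

lemma e_mul_b (i : Fin (n + 1)) : e q i * b q = als q i := by
  rw [b, Finset.mul_sum, Finset.sum_eq_single i, e_mul_als]
  · intro j _ hj
    rw [← e_mul_als, ← mul_assoc, e_mul_e_of_ne q hj.symm, zero_mul]
  · simp

lemma b_mul_e (i : Fin (n + 1)) : b q * e q (i + 1) = als q i := by
  rw [b, Finset.sum_mul, Finset.sum_eq_single i, als_mul_e]
  · intro j _ hj
    rw [← als_mul_e, mul_assoc, e_mul_e_of_ne q (by simpa using hj), mul_zero]
  · simp

lemma al_mul_b (i : Fin (n + 1)) : al q i * b q = al q i * als q i := by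
  rw [← al_mul_e, mul_assoc, e_mul_b, mul_assoc, e_mul_als]

lemma als_mul_a (i : Fin (n + 1)) : als q i * a q = als q i * al q i := by
  rw [← als_mul_e, mul_assoc, e_mul_a, mul_assoc, e_mul_al]

/-- Each factor a moves one vertex forward; a^m followed from i therefore ends at i + m. -/
lemma a_pow_mul_e (m : ℕ) (i : Fin (n + 1)) : a q ^ m * e q i = e q (i + m • 1) * a q ^ m := by
  induction m with
  | zero => simp
  | succ m ih =>
    rw [pow_succ', mul_assoc, ih, succ_nsmul, ← add_assoc, ← mul_assoc, a_mul_e, ← mul_assoc,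
      e_mul_a]

lemma e_mul_b_pow (m : ℕ) (i : Fin (n + 1)) : e q i * b q ^ m = b q ^ m * e q (i + m • 1) := by
  induction m with
  | zero => simp
  | succ m ih =>
    rw [pow_succ, ← mul_assoc, ih, succ_nsmul, ← add_assoc, mul_assoc, mul_assoc, b_mul_e, e_mul_b]

section Coefficients

variable (hq : ∏ i, q i = 1) (ρ : ℂˣ)
include hq

/-- Since c is a central unit, Z may be sent to ρ c. The scale ρ is chosen to match a polynomial
with roots ρ Q_i. -/
lemma exists_laurent_hom : ∃ ζ : ℂ[T;T⁻¹] →ₐ[ℂ] MultPreproj q,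
    ζ (T 1) = (ρ : ℂ) • central q ∧ ∀ r x, Commute (ζ r) x := by
  obtain ⟨u, hu⟩ := isUnit_central q hq
  let v : (MultPreproj q)ˣ := Units.map (algebraMap ℂ (MultPreproj q)).toMonoidHom ρ * u
  have hv : (v : MultPreproj q) = (ρ : ℂ) • central q := by
    rw [Algebra.smul_def, ← hu]
    rfl
  refine ⟨evalUnit v, by rw [evalUnit_T, zpow_one, hv], fun r x => ?_⟩
  induction r using LaurentPolynomial.induction_on' with
  | add f g hf hg => rw [map_add]; exact hf.add_left hg
  | C_mul_T k c =>
    rw [map_mul, evalUnit_T, C_eq_algebraMap, AlgHom.commutes]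
    refine (Algebra.commute_algebraMap_left c x).mul_left ?_
    have : Commute (v : MultPreproj q) x := by
      rw [hv]
      exact (central_commute q hq x).smul_left _
    exact this.units_zpow_left k

end Coefficients

/-- The Laurent polynomial `(ρ Q_i)⁻¹ Z - 1`. -/
noncomputable def linearFactor (ρ : ℂˣ) (i : Fin (n + 1)) : ℂ[T;T⁻¹] :=
  C ((ρ : ℂ) * Q q i)⁻¹ * T 1 - 1

section Spanning

variable {q} {ρ : ℂˣ} {ζ : ℂ[T;T⁻¹] →ₐ[ℂ] MultPreproj q} (hζ : ζ (T 1) = (ρ : ℂ) • central q)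
include hζ

/-- The scale ρ cancels, leaving the coefficient that appears in `al_mul_als` and `als_mul_al`. -/
lemma map_linearFactor (i : Fin (n + 1)) :
    ζ (linearFactor q ρ i) = (Q q i)⁻¹ • central q - 1 := by
  rw [linearFactor, map_sub, map_mul, hζ, map_one, C_eq_algebraMap, AlgHom.commutes, ← Algebra.smul_def,
    smul_smul, mul_inv, mul_right_comm, inv_mul_cancel₀ ρ.ne_zero, one_mul]

lemma z_eq_map (hq : ∏ i, q i = 1) : arr q .z = ζ (C (ρ : ℂ)⁻¹ * T 1) * e q (Fin.last n) := by
  rw [z_eq_central q hq, map_mul, hζ, C_eq_algebraMap, AlgHom.commutes, ← Algebra.smul_def,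
    smul_smul, inv_mul_cancel₀ ρ.ne_zero, one_smul]

lemma zInv_eq_map (hq : ∏ i, q i = 1) :
    arr q .zInv = ζ (C (ρ : ℂ) * T (-1)) * e q (Fin.last n) := by
  have h : ζ (C (ρ : ℂ) * T (-1)) * ζ (C (ρ : ℂ)⁻¹ * T 1) = 1 := by
    rw [← map_mul, mul_mul_mul_comm, ← map_mul, ← T_add, mul_inv_cancel₀ ρ.ne_zero]
    simp
  have h1 : e q (Fin.last n) * arr q .zInv = arr q .zInv := e_target_mul_arr q .zInv
  rw [← z_mul_zInv, z_eq_map hζ hq, ← mul_assoc, ← mul_assoc, h, one_mul, h1]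

/-- The span contains 1 and is stable under left multiplication by every generator: an arrow meeting
a power of the opposite kind cancels one factor into a central coefficient. -/
lemma mem_closure_monomials (hq : ∏ i, q i = 1) (hc : ∀ r x, Commute (ζ r) x) (w : MultPreproj q) :
    w ∈ AddSubgroup.closure {w | ∃ (r : ℂ[T;T⁻¹]) (i : Fin (n + 1)) (m : ℕ),
      w = ζ r * e q i * a q ^ m ∨ w = ζ r * e q i * b q ^ m} := by
  set W := AddSubgroup.closure {w | ∃ (r : ℂ[T;T⁻¹]) (i : Fin (n + 1)) (m : ℕ),
      w = ζ r * e q i * a q ^ m ∨ w = ζ r * e q i * b q ^ m} with hW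
  have ha (r i m) : ζ r * e q i * a q ^ m ∈ W := AddSubgroup.subset_closure ⟨r, i, m, .inl rfl⟩
  have hb (r i m) : ζ r * e q i * b q ^ m ∈ W := AddSubgroup.subset_closure ⟨r, i, m, .inr rfl⟩
  have one_mem : (1 : MultPreproj q) ∈ W := by
    rw [← sum_e]
    exact sum_mem fun i _ => by simpa using ha 1 i 0
  -- Coefficients are central, so stability under x need only be checked on monomials with
  -- coefficient 1.
  have of_generators (x : MultPreproj q) (h1 : ∀ i m, x * e q i * a q ^ m ∈ W)
      (h2 : ∀ i m, x * e q i * b q ^ m ∈ W) (hζW : ∀ r, ∀ w ∈ W, ζ r * w ∈ W) :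
      ∀ w ∈ W, x * w ∈ W := by
    intro w hw
    induction hw using AddSubgroup.closure_induction with
    | mem w hw =>
      obtain ⟨r, i, m, rfl | rfl⟩ := hw
      · rw [← mul_assoc, ← mul_assoc, ← (hc r x).eq, mul_assoc (ζ r), mul_assoc (ζ r)]
        exact hζW _ _ (h1 i m)
      · rw [← mul_assoc, ← mul_assoc, ← (hc r x).eq, mul_assoc (ζ r), mul_assoc (ζ r)]
        exact hζW _ _ (h2 i m)
    | zero => rw [mul_zero]; exact zero_mem _
    | add a b _ _ ha hb => rw [mul_add]; exact add_mem ha hb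
    | neg a _ ha => rw [mul_neg]; exact neg_mem ha
  have hζW (r) : ∀ w ∈ W, ζ r * w ∈ W := by
    intro w hw
    induction hw using AddSubgroup.closure_induction with
    | mem w hw =>
      obtain ⟨s, i, m, rfl | rfl⟩ := hw
      · rw [← mul_assoc, ← mul_assoc, ← map_mul]
        exact ha _ _ _
      · rw [← mul_assoc, ← mul_assoc, ← map_mul]
        exact hb _ _ _
    | zero => rw [mul_zero]; exact zero_mem _
    | add a b _ _ ha hb => rw [mul_add]; exact add_mem ha hb
    | neg a _ ha => rw [mul_neg]; exact neg_mem ha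
  have heW (j) : ∀ w ∈ W, e q j * w ∈ W := by
    refine of_generators _ (fun i m => ?_) (fun i m => ?_) hζW
    · by_cases h : j = i
      · rw [h, e_mul_self, ← one_mul (e q i), ← map_one ζ]; exact ha _ _ _
      · rw [e_mul_e_of_ne q h, zero_mul]; exact zero_mem _
    · by_cases h : j = i
      · rw [h, e_mul_self, ← one_mul (e q i), ← map_one ζ]; exact hb _ _ _
      · rw [e_mul_e_of_ne q h, zero_mul]; exact zero_mem _
  suffices H : ∀ x : MultPreproj q, ∀ w ∈ W, x * w ∈ W by simpa using H w 1 one_mem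
  intro x
  induction x using induction with
  | algebraMap c => rw [← AlgHom.commutes ζ]; exact hζW _
  | e i => exact heW i
  | mul x y hx hy => exact fun w hw => by rw [mul_assoc]; exact hx _ (hy _ hw)
  | add x y hx hy => exact fun w hw => by rw [add_mul]; exact add_mem (hx _ hw) (hy _ hw)
  | arr x =>
    cases x with
    | z => rw [z_eq_map hζ hq]; exact fun w hw => by rw [mul_assoc]; exact hζW _ _ (heW _ _ hw)
    | zInv =>
      rw [zInv_eq_map hζ hq]; exact fun w hw => by rw [mul_assoc]; exact hζW _ _ (heW _ _ hw)
    | alpha j =>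
      change ∀ w ∈ W, al q j * w ∈ W
      have ha' (m) : al q j * a q ^ m ∈ W := by
        rw [← e_mul_a, mul_assoc, ← pow_succ', ← one_mul (e q _), ← map_one ζ]
        exact ha _ _ _
      refine of_generators _ (fun i m => ?_) (fun i m => ?_) hζW
      · by_cases h : j = i
        · rw [h, al_mul_e, ← h]
          exact ha' m
        · rw [← al_mul_e, mul_assoc (al q j), e_mul_e_of_ne q h, mul_zero, zero_mul]; exact zero_mem _
      · by_cases h : j = i
        · rw [h, al_mul_e, ← h]
          -- For m = 0 there is no b to cancel, and the monomial belongs to the a-family.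
          rcases m with _ | m
          · rw [pow_zero, ← pow_zero (a q)]
            exact ha' 0
          · rw [pow_succ', ← mul_assoc, al_mul_b, al_mul_als q hq, ← map_linearFactor hζ]
            exact hb _ _ _
        · rw [← al_mul_e, mul_assoc (al q j), e_mul_e_of_ne q h, mul_zero, zero_mul]; exact zero_mem _
    | alphaStar j =>
      change ∀ w ∈ W, als q j * w ∈ W
      have hb' (m) : als q j * b q ^ m ∈ W := by
        rw [← e_mul_b, mul_assoc, ← pow_succ', ← one_mul (e q _), ← map_one ζ]
        exact hb _ _ _
      refine of_generators _ (fun i m => ?_) (fun i m => ?_) hζW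
      · by_cases h : j + 1 = i
        · rw [← h, als_mul_e]
          rcases m with _ | m
          · rw [pow_zero, ← pow_zero (b q)]
            exact hb' 0
          · rw [pow_succ', ← mul_assoc, als_mul_a, als_mul_al, ← map_linearFactor hζ]
            exact ha _ _ _
        · rw [← als_mul_e, mul_assoc (als q j), e_mul_e_of_ne q h, mul_zero, zero_mul]; exact zero_mem _
      · by_cases h : j + 1 = i
        · rw [← h, als_mul_e]
          exact hb' m
        · rw [← als_mul_e, mul_assoc (als q j), e_mul_e_of_ne q h, mul_zero, zero_mul]; exact zero_mem _

end Spanning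

end MultPreproj

/-! ### Compression to a corner. -/

section CornerMonomials

variable {B : Type} [Ring B] {e : B} (he : IsIdempotentElem e)

lemma IsIdempotentElem.Corner.coe_one : (1 : he.Corner).1 = e := rfl

lemma IsIdempotentElem.Corner.coe_mul (x y : he.Corner) : (x * y).1 = x.1 * y.1 := rfl

/-- The compression `w ↦ e w e`. -/
def IsIdempotentElem.compress : B →+ he.Corner where
  toFun w := ⟨e * w * e, ⟨w, rfl⟩⟩
  map_zero' := Subtype.ext (by simp; rfl)
  map_add' x y := Subtype.ext (by
    change e * (x + y) * e = e * x * e + e * y * e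
    rw [mul_add, add_mul])

lemma IsIdempotentElem.coe_compress (w : B) : (he.compress w).1 = e * w * e := rfl

lemma IsIdempotentElem.compress_coe (x : he.Corner) : he.compress x.1 = x := by
  have hx := (Subsemigroup.mem_corner_iff he).1 x.2
  exact Subtype.ext (by rw [coe_compress, hx.1, hx.2])

/-- Compression is not multiplicative in general; it is enough that one factor commutes with e, as
central coefficients and powers of a^{n+1} and b^{n+1} do in the application. -/
lemma IsIdempotentElem.compress_mul_of_commute {w : B} (hw : Commute w e) (v : B) :
    he.compress (v * w) = he.compress v * he.compress w := by
  apply Subtype.ext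
  rw [Corner.coe_mul, coe_compress, coe_compress, coe_compress]
  simp only [mul_assoc]
  rw [← mul_assoc e e, he.eq, ← mul_assoc e w, ← hw.eq, mul_assoc w, he.eq]

lemma IsIdempotentElem.compress_one : he.compress 1 = 1 := 
  Subtype.ext (by rw [coe_compress, mul_one, he.eq]; rfl)

lemma IsIdempotentElem.compress_pow {w : B} (hw : Commute w e) (k : ℕ) :
    he.compress (w ^ k) = he.compress w ^ k := by
  induction k with
  | zero => rw [pow_zero, pow_zero, compress_one]
  | succ k ih => rw [pow_succ, compress_mul_of_commute he hw, ih, pow_succ]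

/-- The compression of central coefficients. -/
def IsIdempotentElem.compressHom {k R : Type} [CommRing k] [Algebra k B] [Ring R] [Algebra k R]
    (ζ : R →ₐ[k] B) (hc : ∀ r, Commute (ζ r) e) : R →ₐ[k] he.Corner where
  toFun r := he.compress (ζ r)
  map_one' := by rw [map_one, compress_one]
  map_mul' r s := by rw [map_mul, compress_mul_of_commute he (hc s)]
  map_zero' := by rw [map_zero, map_zero]
  map_add' r s := by rw [map_add, map_add]
  commutes' c := Subtype.ext (by
    change e * ζ _ * e = c • e
    rw [AlgHom.commutes, ← Algebra.commutes, mul_assoc, he.eq, ← Algebra.smul_def])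

/-- The diagonal entry of a matrix representation that maps `e` to a diagonal matrix unit, restricted
to the corner at `e`. -/
def IsIdempotentElem.entryHom {k L ι : Type} [CommRing k] [Algebra k B] [CommRing L]
    [Algebra k L] [Fintype ι] [DecidableEq ι]
    (Φ : B →ₐ[k] Matrix ι ι L) (l : ι) (hl : Φ e = Matrix.single l l 1) : he.Corner →ₐ[k] L where
  toFun x := Φ x.1 l l
  map_one' := by rw [Corner.coe_one, hl, Matrix.single_apply_same]
  map_mul' x y := by
    have hx : Φ x.1 = Φ x.1 * Matrix.single l l 1 := by
      rw [← hl, ← map_mul, ((Subsemigroup.mem_corner_iff he).1 x.2).2]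
    rw [Corner.coe_mul, map_mul, Matrix.mul_apply, Finset.sum_eq_single l]
    · intro j _ hj
      rw [hx, Matrix.mul_single_apply_of_ne _ _ _ _ _ hj, zero_mul]
    · simp
  map_zero' := by
    change Φ 0 l l = 0
    rw [map_zero, Matrix.zero_apply]
  map_add' x y := by
    change Φ (x.1 + y.1) l l = _
    rw [map_add, Matrix.add_apply]
  commutes' c := by
    change Φ (c • e) l l = _
    rw [map_smul, hl, Matrix.smul_apply, Matrix.single_apply_same, Algebra.algebraMap_eq_smul_one]

lemma IsIdempotentElem.entryHom_compress {k L ι : Type} [CommRing k] [Algebra k B] [CommRing L]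
    [Algebra k L] [Fintype ι] [DecidableEq ι]
    (Φ : B →ₐ[k] Matrix ι ι L) (l : ι) (hl : Φ e = Matrix.single l l 1) (w : B) :
    he.entryHom Φ l hl (he.compress w) = Φ w l l := by
  change Φ (e * w * e) l l = _
  rw [map_mul, map_mul, hl, Matrix.mul_single_apply_same, Matrix.single_mul_apply_same, mul_one,
    one_mul]

end CornerMonomials

/-! ### The corner algebra and its Laurent matrix representation. -/

namespace MultPreproj

open LaurentPolynomial

variable {n : ℕ} (q : Fin (n + 1) → ℂˣ)

lemma a_pow_commute_e_last : Commute (a q ^ (n + 1)) (e q (Fin.last n)) := by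
  have := a_pow_mul_e q (n + 1) (Fin.last n)
  rwa [(Fin.nsmul_one_eq_zero_iff n _).2 dvd_rfl, add_zero] at this

lemma b_pow_commute_e_last : Commute (b q ^ (n + 1)) (e q (Fin.last n)) := by
  have := e_mul_b_pow q (n + 1) (Fin.last n)
  rw [(Fin.nsmul_one_eq_zero_iff n _).2 dvd_rfl, add_zero] at this
  exact this.symm

/-- A path that only goes forward returns to its starting vertex only after whole turns. -/
lemma compress_a_pow_of_not_dvd {m : ℕ} (h : ¬ n + 1 ∣ m) :
    (isIdempotentElem_e q (Fin.last n)).compress (a q ^ m) = 0 := by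
  apply Subtype.ext
  rw [IsIdempotentElem.coe_compress, mul_assoc, a_pow_mul_e, ← mul_assoc, e_mul_e_of_ne, zero_mul]
  · rfl
  · rwa [Ne, left_eq_add, Fin.nsmul_one_eq_zero_iff]

lemma compress_b_pow_of_not_dvd {m : ℕ} (h : ¬ n + 1 ∣ m) :
    (isIdempotentElem_e q (Fin.last n)).compress (b q ^ m) = 0 := by
  apply Subtype.ext
  rw [IsIdempotentElem.coe_compress, e_mul_b_pow, mul_assoc, e_mul_e_of_ne, mul_zero]
  · rfl
  · rwa [Ne, add_eq_left, Fin.nsmul_one_eq_zero_iff]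

section

variable {q} {ρ : ℂˣ} {ζ : ℂ[T;T⁻¹] →ₐ[ℂ] MultPreproj q}

/-- Compressing the spanning monomials kills those at other vertices and those of length not
divisible by n + 1; the others are coefficients times powers of the two full turns. -/
lemma signedEval_corner_surjective (hζ : ζ (T 1) = (ρ : ℂ) • central q)
    (hq : ∏ i, q i = 1) (hc : ∀ r x, Commute (ζ r) x) :
    Function.Surjective (signedEval
      ((isIdempotentElem_e q (Fin.last n)).compressHom ζ (fun r => hc r _) : ℂ[T;T⁻¹] →+* _)
      ((isIdempotentElem_e q (Fin.last n)).compress (a q ^ (n + 1)))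
      ((isIdempotentElem_e q (Fin.last n)).compress (b q ^ (n + 1)))) := by
  set he := isIdempotentElem_e q (Fin.last n)
  set F := signedEval
      (he.compressHom ζ (fun r => hc r _) : ℂ[T;T⁻¹] →+* _)
      (he.compress (a q ^ (n + 1)))
      (he.compress (b q ^ (n + 1))) with hF
  suffices H : ∀ w, he.compress w ∈ F.range by
    intro x
    have := H x.1
    rwa [IsIdempotentElem.compress_coe] at this
  have coeff_compress (r i w) : he.compress (ζ r * e q i * w) =
      if i = Fin.last n then
        he.compressHom ζ (fun r => hc r _) r * he.compress w else 0 := by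
    split_ifs with hi
    · apply Subtype.ext
      change _ * _ * _ = e q (Fin.last n) * ζ r * e q (Fin.last n) *
        (e q (Fin.last n) * w * e q (Fin.last n))
      rw [hi]
      simp only [mul_assoc]
      rw [← mul_assoc (e q (Fin.last n)) (e q (Fin.last n)), he.eq]
    · apply Subtype.ext
      change _ * _ * _ = (0 : MultPreproj q)
      rw [(hc r _).eq, mul_assoc (e q i), ← mul_assoc (e q _) (e q i), e_mul_e_of_ne q (Ne.symm hi),
        zero_mul, zero_mul]
  intro w
  have hw := mem_closure_monomials hζ hq hc w
  induction hw using AddSubgroup.closure_induction with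
  | mem w hw =>
    obtain ⟨r, i, m, rfl | rfl⟩ := hw
    all_goals
      rw [coeff_compress]
      split_ifs
      swap
      · exact zero_mem _
      by_cases hm : n + 1 ∣ m
      swap
      · simp only [compress_a_pow_of_not_dvd q hm, compress_b_pow_of_not_dvd q hm, mul_zero]
        exact zero_mem _
      obtain ⟨k, rfl⟩ := hm
    · rw [pow_mul, he.compress_pow (a_pow_commute_e_last q)]
      exact closure_le_range_signedEval _ _ _ (AddSubgroup.subset_closure ⟨r, k, .inl rfl⟩)
    · rw [pow_mul, he.compress_pow (b_pow_commute_e_last q)]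
      exact closure_le_range_signedEval _ _ _ (AddSubgroup.subset_closure ⟨r, k, .inr rfl⟩)
  | zero => rw [map_zero]; exact zero_mem _
  | add a b _ _ ha hb => rw [map_add]; exact add_mem ha hb
  | neg a _ ha => rw [map_neg]; exact neg_mem ha

end

section Representation

variable (ρ : ℂˣ)

lemma one_add_linearFactor (i : Fin (n + 1)) :
    1 + linearFactor q ρ i = C ((ρ : ℂ) * Q q i)⁻¹ * T 1 := by
  rw [linearFactor, add_sub_cancel]

variable (hq : ∏ i, q i = 1)
include hq

/-- This is the vertex relation as seen in the matrix representation; it amounts to Q_{i+1} = Q_i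
q_{i+1}. -/
lemma one_add_linearFactor_eq_smul (i : Fin (n + 1)) :
    1 + linearFactor q ρ i = (q (i + 1) : ℂ) • (1 + linearFactor q ρ (i + 1)) := by
  have h : ((ρ : ℂ) * Q q i)⁻¹ = q (i + 1) * ((ρ : ℂ) * Q q (i + 1))⁻¹ := by
    rw [Q, Q, partialProduct_add_one q hq, Units.val_mul]
    field_simp
  rw [one_add_linearFactor, one_add_linearFactor, smul_eq_C_mul, ← mul_assoc, ← map_mul, h]

omit hq in
/-- The matrix of an arrow in the representation below. -/
noncomputable def arrowMatrix : CyclicArrow n → Matrix (Fin (n + 1)) (Fin (n + 1)) ℂ[T;T⁻¹][T;T⁻¹]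
  | .alpha i => Matrix.single (i + 1) i (T 1)
  | .alphaStar i => Matrix.single i (i + 1) (C (linearFactor q ρ i) * T (-1))
  | .z => Matrix.single (Fin.last n) (Fin.last n) (C (C (ρ : ℂ)⁻¹ * T 1))
  | .zInv => Matrix.single (Fin.last n) (Fin.last n) (C (C (ρ : ℂ) * T (-1)))

/-- A matrix representation of `Λ^q(Ã_n)` over `ℂ[Z^{±1}][T^{±1}]`. -/
noncomputable def matrixRep :
    MultPreproj q →ₐ[ℂ] Matrix (Fin (n + 1)) (Fin (n + 1)) ℂ[T;T⁻¹][T;T⁻¹] :=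
  lift q (fun i => Matrix.single i i 1) (arrowMatrix q ρ)
    (fun i => by rw [Matrix.single_mul_single_same, mul_one])
    (fun i j h => by rw [Matrix.single_mul_single_of_ne _ _ _ _ h])
    (Matrix.sum_single_one)
    (fun a => by cases a <;> simp [arrowMatrix, CyclicArrow.target])
    (fun a => by cases a <;> simp [arrowMatrix, CyclicArrow.source])
    (by
      rw [arrowMatrix, arrowMatrix, Matrix.single_mul_single_same, ← map_mul, mul_mul_mul_comm,
        ← map_mul, ← T_add, inv_mul_cancel₀ ρ.ne_zero]
      simp)
    (by
      rw [arrowMatrix, arrowMatrix, Matrix.single_mul_single_same, ← map_mul, mul_mul_mul_comm,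
        ← map_mul, ← T_add, mul_inv_cancel₀ ρ.ne_zero]
      simp)
    (by
      rw [arrowMatrix, arrowMatrix, arrowMatrix, Matrix.single_mul_single_same, mul_assoc, ← T_add,
        ← Matrix.single_add, neg_add_cancel, T_zero, mul_one, ← map_one C, ← map_add,
        one_add_linearFactor, Q, partialProduct_last q hq, Units.val_one, mul_one])
    (fun i => by
      rw [arrowMatrix, arrowMatrix, arrowMatrix, arrowMatrix, Matrix.single_mul_single_same,
        Matrix.single_mul_single_same, ← smul_add, ← Matrix.single_add, ← Matrix.single_add,
        mul_left_comm, mul_assoc, ← T_add, ← T_add, neg_add_cancel,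
        add_neg_cancel, T_zero, mul_one, mul_one, ← map_one C, ← map_add, ← map_add,
        one_add_linearFactor_eq_smul q ρ hq, Matrix.smul_single, C_smul])

lemma matrixRep_e (i : Fin (n + 1)) : matrixRep q ρ hq (e q i) = Matrix.single i i 1 := lift_e ..

lemma matrixRep_al (i : Fin (n + 1)) :
    matrixRep q ρ hq (al q i) = Matrix.single (i + 1) i (T 1) := lift_arr ..

lemma matrixRep_als (i : Fin (n + 1)) :
    matrixRep q ρ hq (als q i) = Matrix.single i (i + 1) (C (linearFactor q ρ i) * T (-1)) :=
  lift_arr ..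

lemma matrixRep_central (i : Fin (n + 1)) :
    matrixRep q ρ hq ((ρ : ℂ) • central q * e q i) = Matrix.single i i (C (T 1)) := by
  rw [smul_mul_assoc, central_mul_e, map_smul, map_smul, map_add, map_mul, matrixRep_e,
    matrixRep_al, matrixRep_als, Matrix.single_mul_single_same, mul_assoc, ← T_add, neg_add_cancel,
    T_zero, mul_one, ← Matrix.single_add, ← map_one C, ← map_add, one_add_linearFactor, smul_smul,
    Matrix.smul_single]
  rw [← C_smul, smul_eq_C_mul, ← mul_assoc, ← map_mul, mul_inv_cancel₀, map_one, one_mul]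
  exact mul_ne_zero ρ.ne_zero (Q_ne_zero q i)

lemma matrixRep_a_pow (m : ℕ) (i : Fin (n + 1)) :
    matrixRep q ρ hq (a q ^ m * e q i) = Matrix.single (i + m • 1) i (T m) := by
  induction m with
  | zero => simp [matrixRep_e]
  | succ m ih =>
    have h : a q ^ (m + 1) * e q i = al q (i + m • 1) * (a q ^ m * e q i) := by
      rw [pow_succ', mul_assoc, a_pow_mul_e, ← mul_assoc, ← mul_assoc, a_mul_e, al_mul_e]
    rw [h, map_mul, ih, matrixRep_al, Matrix.single_mul_single_same, ← T_add, succ_nsmul, add_assoc]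
    push_cast
    rw [add_comm (1 : ℤ)]

/-- The linear factors are all placed on the α_i^*, so powers of b collect one per edge while powers
of a collect none. -/
lemma matrixRep_b_pow (m : ℕ) (i : Fin (n + 1)) :
    matrixRep q ρ hq (e q i * b q ^ m) = Matrix.single i (i + m • 1)
      (C (∏ k ∈ Finset.range m, linearFactor q ρ (i + k • 1)) * T (-m)) := by
  induction m with
  | zero => simp [matrixRep_e]
  | succ m ih =>
    have h : e q i * b q ^ (m + 1) = e q i * b q ^ m * als q (i + m • 1) := by
      rw [pow_succ, ← mul_assoc, e_mul_b_pow, mul_assoc, e_mul_b, mul_assoc, e_mul_als]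
    rw [h, map_mul, ih, matrixRep_als, Matrix.single_mul_single_same, mul_mul_mul_comm, ← T_add,
      succ_nsmul, add_assoc, Finset.prod_range_succ, map_mul]
    push_cast
    rw [neg_add]

end Representation

lemma prod_linearFactor_range (ρ : ℂˣ) (i : Fin (n + 1)) :
    ∏ k ∈ Finset.range (n + 1), linearFactor q ρ (i + k • 1) = ∏ k, linearFactor q ρ k := by
  rw [Finset.prod_range]
  simp only [Fin.val_nsmul_one]
  exact Equiv.prod_comp (Equiv.addLeft i) (linearFactor q ρ)

/-- Each Z - ρ Q_i is ρ Q_i times a normalised factor, so the constant is the leading coefficient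
times the product of the roots. -/
lemma toLaurent_eq_prod_linearFactor (ρ : ℂˣ) (P : Polynomial ℂ) (hP : P.natDegree = n + 1)
    (hr : P.roots = Finset.univ.val.map fun i => (ρ : ℂ) * Q q i) :
    ∃ c : ℂ, c ≠ 0 ∧ Polynomial.toLaurent P = C c * ∏ i, linearFactor q ρ i := by
  refine ⟨P.leadingCoeff * ∏ i, ((ρ : ℂ) * Q q i), mul_ne_zero ?_ (Finset.prod_ne_zero_iff.2
    fun i _ => mul_ne_zero ρ.ne_zero (Q_ne_zero q i)), ?_⟩
  · rw [Polynomial.leadingCoeff_ne_zero]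
    rintro rfl
    simp at hP
  · conv_lhs => rw [← Polynomial.C_leadingCoeff_mul_prod_multiset_X_sub_C (p := P) (by simp [hr, hP])]
    rw [hr, Multiset.map_map, map_mul, Polynomial.toLaurent_C, map_mul, mul_assoc, map_prod C,
      ← Finset.prod_mul_distrib]
    congr 1
    refine (map_prod (Polynomial.toLaurent (R := ℂ)) _ _).trans (Finset.prod_congr rfl fun i _ => ?_)
    rw [linearFactor, mul_sub, ← mul_assoc, ← map_mul C,
      mul_inv_cancel₀ (mul_ne_zero ρ.ne_zero (Q_ne_zero q i))]
    simp [-map_mul]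

/-- The corner of `Λ^q(Ã_n)` at the last vertex is `ℂ[X, Y, Z^{±1}] / (P(Z) - XY)`. -/
theorem nonempty_corner_algEquiv (hq : ∏ i, q i = 1) (ρ : ℂˣ) (P : Polynomial ℂ)
    (hP : P.natDegree = n + 1) (hr : P.roots = Finset.univ.val.map fun i => (ρ : ℂ) * Q q i) :
    Nonempty (Corner q ≃ₐ[ℂ] LocalizedMilnorFibreRing P) := by
  obtain ⟨ζ, hζ, hc⟩ := exists_laurent_hom q hq ρ
  obtain ⟨c, hc0, hPc⟩ := toLaurent_eq_prod_linearFactor q ρ P hP hr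
  have hP0 : P ≠ 0 := by
    rintro rfl
    simp at hP
  let he := isIdempotentElem_e q (Fin.last n)
  have hadd : Fin.last n + (n + 1) • 1 = Fin.last n := by
    rw [(Fin.nsmul_one_eq_zero_iff n _).2 dvd_rfl, add_zero]
  -- The entry can be read with the idempotent on either side; powers of a are known with it on the
  -- right and powers of b with it on the left.
  have hent (w : MultPreproj q) : he.entryHom (matrixRep q ρ hq) (Fin.last n) (matrixRep_e q ρ hq _)
      (he.compress w) = matrixRep q ρ hq (w * e q (Fin.last n)) (Fin.last n) (Fin.last n) := by
    rw [he.entryHom_compress, map_mul, matrixRep_e, Matrix.mul_single_apply_same, mul_one]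
  have hent' (w : MultPreproj q) : he.entryHom (matrixRep q ρ hq) (Fin.last n) (matrixRep_e q ρ hq _)
      (he.compress w) = matrixRep q ρ hq (e q (Fin.last n) * w) (Fin.last n) (Fin.last n) := by
    rw [he.entryHom_compress, map_mul, matrixRep_e, Matrix.single_mul_apply_same, one_mul]
  refine HyperbolaRing.nonempty_algEquiv ℂ (Polynomial.toLaurent P)
    (he.entryHom (matrixRep q ρ hq) (Fin.last n) (matrixRep_e q ρ hq _))
    (he.compressHom ζ (fun r => hc r _) : ℂ[T;T⁻¹] →+* _) (he.compress (a q ^ (n + 1)))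
    (he.compress (b q ^ (n + 1))) (signedEval_corner_surjective hζ hq hc) (n + 1) n.succ_ne_zero
    (∏ i, linearFactor q ρ i) (C c⁻¹) (C c) (by rw [← map_mul, mul_inv_cancel₀ hc0, map_one]) ?_
    (Polynomial.toLaurent_ne_zero.2 hP0) ?_ ?_ ?_
  · rw [hPc, ← mul_assoc, ← map_mul, inv_mul_cancel₀ hc0, map_one, one_mul]
  -- Algebra maps out of ℂ[Z^{±1}] agree once they agree on Z, and ρ c has diagonal entry Z.
  · have h : (he.entryHom (matrixRep q ρ hq) (Fin.last n) (matrixRep_e q ρ hq _)).comp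
        (he.compressHom ζ (fun r => hc r _)) = Algebra.algHom ℂ ℂ[T;T⁻¹] ℂ[T;T⁻¹][T;T⁻¹] := by
      refine algHom_ext_T ((hent _).trans ?_)
      rw [hζ, matrixRep_central, Matrix.single_apply_same]
      rfl
    exact fun r => DFunLike.congr_fun h r
  · rw [hent, matrixRep_a_pow, hadd, Matrix.single_apply_same]
  · rw [hent', matrixRep_b_pow, hadd, Matrix.single_apply_same, prod_linearFactor_range]

end MultPreproj

/-! ### Inverting Z on the Milnor fibre. -/

section Localization

variable (P : Polynomial ℂ)

namespace MilnorFibreRing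

open LaurentPolynomial

noncomputable def x (i : Fin 3) : MilnorFibreRing P := Ideal.Quotient.mk _ (MvPolynomial.X i)

lemma aeval_x_two : Polynomial.aeval (x P 2) P = x P 0 * x P 1 := by
  have := Ideal.Quotient.eq_zero_iff_mem.2 (Ideal.mem_span_singleton_self
    (Polynomial.aeval (MvPolynomial.X 2 : MvPolynomial (Fin 3) ℂ) P - MvPolynomial.X 0 * MvPolynomial.X 1))
  rw [map_sub, sub_eq_zero, map_mul, ← Ideal.Quotient.mkₐ_eq_mk ℂ, ← Polynomial.aeval_algHom_apply] at this
  exact this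

variable {P} {S : Type*} [CommRing S] [Algebra ℂ S]

noncomputable def lift (u v w : S) (h : Polynomial.aeval w P = u * v) : MilnorFibreRing P →ₐ[ℂ] S :=
  Ideal.Quotient.liftₐ _ (MvPolynomial.aeval ![u, v, w]) (by
    refine fun a ha => (Ideal.span_le (I := RingHom.ker _)).2 ?_ ha
    rintro _ rfl
    rw [SetLike.mem_coe, RingHom.mem_ker]
    change MvPolynomial.aeval ![u, v, w] (_ - MvPolynomial.X 0 * MvPolynomial.X 1) = 0
    rw [map_sub, map_mul, MvPolynomial.aeval_X, MvPolynomial.aeval_X,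
      ← Polynomial.aeval_algHom_apply, MvPolynomial.aeval_X, sub_eq_zero]
    exact h)

lemma lift_x (u v w : S) (h : Polynomial.aeval w P = u * v) (i : Fin 3) :
    lift u v w h (x P i) = ![u, v, w] i :=
  (Ideal.Quotient.liftₐ_apply _ _ _ _).trans (MvPolynomial.aeval_X _ _)

lemma algHom_ext {f g : MilnorFibreRing P →ₐ[ℂ] S} (h : ∀ i, f (x P i) = g (x P i)) : f = g :=
  Ideal.Quotient.algHom_ext _ (MvPolynomial.algHom_ext h)

variable (P)

/-- Inverting `Z` in `ℂ[X, Y, Z] / (P(Z) - XY)`. -/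
lemma nonempty_away_equiv :
    Nonempty (Localization.Away (x P 2) ≃+* HyperbolaRing (Polynomial.toLaurent P)) := by
  let p := Polynomial.toLaurent P
  let c := HyperbolaRing.coeffsAlg ℂ p
  have hc : Polynomial.aeval (c (T 1)) P = HyperbolaRing.x p 0 * HyperbolaRing.x p 1 := by
    rw [HyperbolaRing.x_zero_mul_x_one, Polynomial.aeval_algHom_apply, aeval_T_one]
    rfl
  -- Mutually inverse maps come from the two universal properties: Z is a unit in the Laurent
  -- coefficients, and Laurent polynomials can be evaluated at the inverted Z.
  let f₀ : MilnorFibreRing P →ₐ[ℂ] HyperbolaRing p :=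
    lift (HyperbolaRing.x p 0) (HyperbolaRing.x p 1) (c (T 1)) hc
  have hf₀ : IsUnit ((f₀ : MilnorFibreRing P →+* HyperbolaRing p) (x P 2)) := by
    change IsUnit (f₀ (x P 2))
    rw [lift_x]
    exact (isUnit_T 1).map c
  let f : Localization.Away (x P 2) →+* HyperbolaRing p := IsLocalization.Away.lift (x P 2) hf₀
  have hf (y) : f (algebraMap _ _ y) = f₀ y := IsLocalization.Away.lift_eq (x P 2) hf₀ y
  let v : (Localization.Away (x P 2))ˣ := (IsLocalization.Away.algebraMap_isUnit (x P 2)).unit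
  let i : MilnorFibreRing P →ₐ[ℂ] Localization.Away (x P 2) := Algebra.algHom ℂ _ _
  let g₀ : ℂ[T;T⁻¹] →ₐ[ℂ] Localization.Away (x P 2) := evalUnit v
  have hg₀ : g₀ (T 1) = i (x P 2) := by
    rw [evalUnit_T, zpow_one]
    rfl
  let g : HyperbolaRing p →ₐ[ℂ] Localization.Away (x P 2) :=
    HyperbolaRing.lift g₀ (i (x P 0)) (i (x P 1)) (by
      rw [← map_mul, ← aeval_x_two, show p = Polynomial.aeval (T 1) P from (aeval_T_one P).symm,
        ← Polynomial.aeval_algHom_apply, ← Polynomial.aeval_algHom_apply, hg₀])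
  have g_coeffs (r) : g (HyperbolaRing.coeffs p r) = g₀ r := HyperbolaRing.lift_coeffs ..
  have g_zero : g (HyperbolaRing.x p 0) = i (x P 0) := HyperbolaRing.lift_x_zero ..
  have g_one : g (HyperbolaRing.x p 1) = i (x P 1) := HyperbolaRing.lift_x_one ..
  have hfi (y) : f (i y) = f₀ y := hf y
  let f' : Localization.Away (x P 2) →ₐ[ℂ] HyperbolaRing p :=
    { f with commutes' := fun a =>
        (congrArg f (i.commutes a).symm).trans ((hf _).trans (f₀.commutes a)) }
  have hf' : f'.comp g₀ = c := algHom_ext_T ((congrArg f hg₀).trans ((hf _).trans (lift_x ..)))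
  refine ⟨RingEquiv.ofRingHom f g ?_ ?_⟩
  · refine HyperbolaRing.hom_ext (fun r => ?_) ?_ ?_
    · exact (congrArg f (g_coeffs r)).trans (DFunLike.congr_fun hf' r)
    · exact (congrArg f g_zero).trans ((hfi _).trans (lift_x ..))
    · exact (congrArg f g_one).trans ((hfi _).trans (lift_x ..))
  · refine IsLocalization.ringHom_ext (Submonoid.powers (x P 2)) ?_
    have : g.comp f₀ = i := by
      refine algHom_ext fun j => ?_
      fin_cases j
      · exact (congrArg g (lift_x _ _ _ hc _)).trans g_zero
      · exact (congrArg g (lift_x _ _ _ hc _)).trans g_one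
      · exact (congrArg g (lift_x _ _ _ hc _)).trans ((g_coeffs _).trans hg₀)
    refine RingHom.ext fun y => ?_
    change g (f (algebraMap _ _ y)) = _
    rw [hf]
    exact DFunLike.congr_fun this y

end MilnorFibreRing

end Localization

/-! ### Consecutive products and distinctness of the roots. -/

section PartialProduct

variable {n : ℕ} (q : Fin (n + 1) → ℂˣ) (hq : ∏ i, q i = 1)
include hq

/-- A consecutive product is a quotient of partial products. For i = 0 the index i - 1 wraps to the
last vertex, whose partial product is 1, the value of the empty product. -/
lemma prod_Icc_mul_partialProduct {i j : Fin (n + 1)} (h : i ≤ j) :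
    (∏ l ∈ Finset.Icc i j, q l) * partialProduct q (i - 1) = partialProduct q j := by
  have h1 : partialProduct q (i - 1) = ∏ l ∈ Finset.Iio i, q l := by
    have := partialProduct_add_one q hq (i - 1)
    rw [sub_add_cancel, partialProduct, ← Finset.Iio_insert, Finset.prod_insert (by simp), mul_comm,
      mul_left_inj] at this
    exact this.symm
  rw [h1, mul_comm, partialProduct, ← Finset.prod_union]
  · congr 1
    ext l
    simp only [Finset.mem_union, Finset.mem_Iio, Finset.mem_Icc, Finset.mem_Iic]
    grind
  · rw [Finset.disjoint_left]
    intro l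
    simp only [Finset.mem_Iio, Finset.mem_Icc]
    grind

/-- The product over [i, j] is trivial exactly when the values at i - 1 and j coincide. As i ≤ j <
last vary, the pairs (i - 1, j) run over all pairs of distinct vertices up to order, the last vertex
arising from i = 0. -/
lemma noTrivialConsecutiveProduct_iff :
    NoTrivialConsecutiveProduct q ↔ Function.Injective (partialProduct q) := by
  have key {i j : Fin (n + 1)} (h : i ≤ j) :
      ∏ l ∈ Finset.Icc i j, q l = 1 ↔ partialProduct q (i - 1) = partialProduct q j := by
    rw [← prod_Icc_mul_partialProduct q hq h, right_eq_mul]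
  constructor
  · intro H
    have hlt (a b : Fin (n + 1)) (hab : a < b) : partialProduct q a ≠ partialProduct q b := by
      intro h
      induction b using Fin.lastCases with
      | last =>
        refine H 0 a (Fin.zero_le _) hab ((key (Fin.zero_le _)).2 ?_)
        rw [h, ← Fin.last_add_one, add_sub_cancel_right]
      | cast b =>
        induction a using Fin.lastCases with
        | last => exact absurd hab (Fin.le_last _).not_gt
        | cast a =>
          have hab' : a.castSucc + 1 ≤ b.castSucc := by
            rw [Fin.coeSucc_eq_succ]
            exact hab
          refine H (a.castSucc + 1) b.castSucc hab' (Fin.castSucc_lt_last b) ((key hab').2 ?_)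
          rw [add_sub_cancel_right, h]
    intro a b h
    rcases lt_trichotomy a b with hab | hab | hab
    · exact absurd h (hlt a b hab)
    · exact hab
    · exact absurd h.symm (hlt b a hab)
  · intro H i j hij hj h
    have := H ((key hij).1 h)
    rw [sub_eq_iff_eq_add] at this
    subst this
    induction j using Fin.lastCases with
    | last => exact lt_irrefl _ hj
    | cast j =>
      rw [Fin.coeSucc_eq_succ] at hij
      exact absurd hij (Fin.castSucc_lt_succ).not_ge

omit hq in
lemma nodup_map_univ_iff {α : Type*} (f : Fin (n + 1) → α) :
    (Finset.univ.val.map f).Nodup ↔ Function.Injective f := by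
  rw [Multiset.nodup_map_iff_inj_on Finset.univ.nodup]
  simp [Function.Injective]

end PartialProduct

/-! ### Assembling the equivalences. -/

section Assembly

open AlgebraicGeometry

lemma IsFullCorner.comp_ringEquiv {A A' S : Type} [Ring A] [Ring A'] [Ring S] {φ : A →ₙ+* S}
    (hφ : IsFullCorner φ) (f : A' ≃+* A) : IsFullCorner (φ.comp (f : A' →ₙ+* A)) where
  injective := hφ.injective.comp f.injective
  exists_eq s := by
    obtain ⟨a, ha⟩ := hφ.exists_eq s
    refine ⟨f.symm a, ?_⟩
    change φ (f (f.symm a)) = φ (f 1) * s * φ (f 1)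
    rw [f.apply_symm_apply, map_one, ha]
  full := by
    obtain ⟨n, x, y, h⟩ := hφ.full
    refine ⟨n, x, y, ?_⟩
    change ∑ i, x i * φ (f 1) * y i = 1
    rw [map_one, h]

lemma nonempty_milnorFibreComplement_iso (P : Polynomial ℂ) :
    Nonempty (milnorFibreComplement P ≅ Spec (.of (LocalizedMilnorFibreRing P))) := by
  obtain ⟨f⟩ := MilnorFibreRing.nonempty_away_equiv P
  exact ⟨basicOpenIsoSpecAway (R := .of (MilnorFibreRing P)) (MilnorFibreRing.x P 2) ≪≫
    Scheme.Spec.mapIso f.symm.toCommRingCatIso.op⟩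

theorem MultPreproj.triangulatedEquivalent_DbCoh {n : ℕ} (q : Fin (n + 1) → ℂˣ) (hq : ∏ i, q i = 1)
    (hQ : Function.Injective (partialProduct q)) (ρ : ℂˣ) (P : Polynomial ℂ)
    (hP : P.natDegree = n + 1) (hr : P.roots = Finset.univ.val.map fun i => (ρ : ℂ) * Q q i) :
    TriangulatedEquivalent (DbCoh (milnorFibreComplement P)) (DbMod (MultPreproj q)) := by
  obtain ⟨e⟩ := nonempty_milnorFibreComplement_iso P
  obtain ⟨f⟩ := nonempty_corner_algEquiv q hq ρ P hP hr
  -- Right modules over the corner are modules over its opposite; since the coordinate ring is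
  -- commutative, it is identified with that opposite and can stand in as the full corner.
  have h := (isFullCorner_cornerInclusion q hq (Units.val_injective.comp hQ)).comp_ringEquiv
    ((RingEquiv.toOpposite (LocalizedMilnorFibreRing P)).trans f.symm.toRingEquiv.op)
  exact (triangulatedEquivalent_DbCoh_of_iso e).symm.trans
    ((triangulatedEquivalent_DbCoh_Spec _).symm.trans h.triangulatedEquivalent.symm)

end Assembly

theorem mainTheorem7 (n : ℕ) :
    (∀ q : Fin (n + 1) → ℂˣ, ∏ i, q i = 1 →
      ∀ P : Polynomial ℂ, P.natDegree = n + 1 →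
        P.roots = Finset.univ.val.map (fun i => (partialProduct q i : ℂ)) →
        Nonempty (MultPreproj.Corner q ≃ₐ[ℂ] LocalizedMilnorFibreRing P) ∧
        (NoTrivialConsecutiveProduct q ↔ P.roots.Nodup) ∧
        (NoTrivialConsecutiveProduct q →
          TriangulatedEquivalent (DbMod (MultPreproj q)) (DbMod (MultPreproj.Corner q)) ∧
          TriangulatedEquivalent (DbCoh (milnorFibreComplement P)) (DbMod (MultPreproj q)))) ∧
    (∀ P : Polynomial ℂ, P.natDegree = n + 1 → P.roots.Nodup → P.eval 0 ≠ 0 →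
      ∀ ρ : Fin (n + 1) → ℂ, P.roots = Finset.univ.val.map ρ →
        ∃ q : Fin (n + 1) → ℂˣ, ∏ i, q i = 1 ∧
          (∀ i, ρ i = ρ (Fin.last n) * (partialProduct q i : ℂ)) ∧
          TriangulatedEquivalent (DbCoh (milnorFibreComplement P)) (DbMod (MultPreproj q))) := by
  constructor
  · intro q hq P hP hr
    -- In the first part the roots are the Q_i themselves, which is the scale ρ = 1.
    have hr' : P.roots = Finset.univ.val.map fun i => ((1 : ℂˣ) : ℂ) * MultPreproj.Q q i := by
      simpa using hr
    refine ⟨MultPreproj.nonempty_corner_algEquiv q hq 1 P hP hr', ?_, fun h => ?_⟩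
    · rw [noTrivialConsecutiveProduct_iff q hq, hr, nodup_map_univ_iff]
      exact (Units.val_injective.of_comp_iff _).symm
    · rw [noTrivialConsecutiveProduct_iff q hq] at h
      exact ⟨(MultPreproj.isFullCorner_cornerInclusion q hq
          (Units.val_injective.comp h)).triangulatedEquivalent,
        MultPreproj.triangulatedEquivalent_DbCoh q hq h 1 P hP hr'⟩
  · intro P hP hnd h0 ρ hr
    have hρ (i) : ρ i ≠ 0 := by
      intro hi
      have : ρ i ∈ P.roots := by
        rw [hr]
        exact Multiset.mem_map_of_mem _ (Finset.mem_univ i)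
      rw [hi] at this
      exact h0 (Polynomial.isRoot_of_mem_roots this)
    let r (i) : ℂˣ := Units.mk0 (ρ i) (hρ i)
    -- Ratios of cyclically consecutive roots: their total product is 1, and their partial products
    -- telescope to ρ_i / ρ_{n+1}.
    let q (i) : ℂˣ := r i / r (i - 1)
    have hq : ∏ i, q i = 1 := by
      rw [Finset.prod_div_distrib, div_eq_one]
      exact (Equiv.prod_comp (Equiv.subRight 1) r).symm
    have hQ (i) : partialProduct q i = r i / r (Fin.last n) := by
      induction i using Fin.induction_cyclic with
      | last => rw [partialProduct_last q hq, div_self']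
      | succ i hi => rw [partialProduct_add_one q hq, hi]; simp [q]
    have hρQ (i) : ρ i = ρ (Fin.last n) * (partialProduct q i : ℂ) := by
      rw [hQ, Units.val_div_eq_div_val]
      exact (mul_div_cancel₀ (ρ i) (hρ _)).symm
    rw [hr, nodup_map_univ_iff] at hnd
    -- Here the scale is the last root, so no normalisation ρ_{n+1} = 1 is required.
    refine ⟨q, hq, hρQ, MultPreproj.triangulatedEquivalent_DbCoh q hq (fun i j hij => hnd ?_)
      (r (Fin.last n)) P hP ?_⟩
    · rw [hρQ i, hρQ j, hij]
    · rw [hr]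
      exact congrArg (Multiset.map · _) (funext hρQ)
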